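/- Setting. For each integer $n\ge 1$ let $G_n=(V_n,E_n,(c_{xy})_{xy\in E_n})$ be a finite connected undirected graph with $|V_n|=n$ and conductances $c_{xy}=c_{yx}>0$, and let $\pi=\pi_n$ be a probability on $V_n$ with $\pi(x)>0$ for all $x$. The dependence on $n$ is mostly omitted. Put $\|\psi\|_p=\big(\sum_x\pi(x)|\psi(x)|^p\big)^{1/p}$ for $1\le p<\infty$, and let $\Delta$ be the set of probability distributions on $V_n$. The single-particle chain has generator $$L\psi(z)=\sum_{xy\in E}c_{xy}\big(P_{xy}\psi(z)-\psi(z)\big),\qquad P_{xy}\psi(z)=\begin{cases}\frac{\pi(x)\psi(x)+\pi(y)\psi(y)}{\pi(x)+\pi(y)}&\text{if } z\in\{x,y\},\\ \psi(z)&\text{otherwise,}\end{cases}$$ and Dirichlet form $\mathcal E(\psi)=\sum_{xy\in E}c_{xy}\frac{\pi(x)\pi(y)}{\pi(x)+\pi(y)}(\psi(x)-\psi(y))^2$. Its spectral gap is $$\mathrm{gap}=\inf\Big\{\tfrac{\sum_x\pi(x)\psi(x)(-L\psi)(x)}{\sum_x\pi(x)\psi(x)^2}:\ \psi\ne0,\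 \sum_x\pi(x)\psi(x)=0\Big\},$$ and $t_{\rm rel}=\mathrm{gap}^{-1}$ is the relaxation time. The Averaging process $(\eta_t)_{t\ge0}$ is the Markov process on $\Delta$ with generator $f\mapsto\sum_{xy\in E}c_{xy}\big(f(\eta^{xy})-f(\eta)\big)$, where $\eta^{xy}(x)=\frac{\pi(x)}{\pi(x)+\pi(y)}(\eta(x)+\eta(y))$, $\eta^{xy}(y)=\frac{\pi(y)}{\pi(x)+\pi(y)}(\eta(x)+\eta(y))$ and $\eta^{xy}(z)=\eta(z)$ for $z\notin\{x,y\}$. Write $\mathbb E_\eta$ for the expectation when the process starts from $\eta\in\Delta$. Assumptions. (1) Finite-dimensional geometries: there are positive $d=d(n)$, $T=T(n)$, $t_{\rm Nash}=t_{\rm Nash}(n)$ such that, for every $n$ and every $\psi:V_n\to\mathbb R$, $$\|\psi\|_2^{2(1+2/d)}\le t_{\rm Nash}\big(\mathcal E(\psi)+T^{-1}\|\psi\|_2^2\big)\|\psi\|_1^{4/d},$$ and, as $n\to\infty$, $d=O(1)$, $t_{\rm Nash}=O(t_{\rm rel})$ and $T=\Theta(t_{\rm Nash})$. (2) Uniform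 ellipticity: there is $c_{\rm ell}\in[1,\infty)$ with $\max_x\pi(x)\le c_{\rm ell}\min_x\pi(x)$ for every $n$. (3) $k=k_n$ is a sequence of natural numbers with $k\to\infty$ and $k=O(n^2)$. Theorem (Cutoff on a finer scale). Let $t^\pm(C)=\frac{t_{\rm rel}}2\log k\pm C\,t_{\rm rel}$. Under (1)--(3), for every $\delta\in(0,1)$ there exists $C>0$, independent of $n$ and $p$, such that for all $p\in[1,2]$ $$\limsup_{n\to\infty}\sqrt k\,\sup_{\eta\in\Delta}\mathbb E_\eta\Big[\Big\|\frac{\eta_{t^+(C)}}{\pi}-1\Big\|_p\Big]\le\delta,\qquad \liminf_{n\to\infty}\sqrt k\,\sup_{\eta\in\Delta}\mathbb E_\eta\Big[\Big\|\frac{\eta_{t^-(C)}}{\pi}-1\Big\|_p\Big]\ge\frac1\delta .$$ -/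

import Mathlib

open Filter Topology Asymptotics

noncomputable section

/-- The semigroup `exp(t A)` generated by a bounded operator `A` on a normed space. -/
def expSemigroup {E : Type*} [NormedAddCommGroup E] [NormedSpace ℝ E] (A : E →L[ℝ] E) (t : ℝ) :
    E →L[ℝ] E :=
  NormedSpace.exp (t • A)

/-- A finite connected undirected graph on `V` with positive conductances on its edges, together
with non-degenerate site-weights, i.e. a probability `wt` (written `π` in the literature) on `V`
with `wt x > 0` for every `x`. The conductance of a pair that is not an edge is `0`. -/
structure WeightedGraph (V : Type*) [Fintype V] where
  graph : SimpleGraph V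
  connected : graph.Connected
  cond : V → V → ℝ
  cond_symm : ∀ x y, cond x y = cond y x
  cond_pos : ∀ x y, graph.Adj x y → 0 < cond x y
  cond_eq_zero : ∀ x y, ¬ graph.Adj x y → cond x y = 0
  wt : V → ℝ
  wt_pos : ∀ x, 0 < wt x
  sum_wt : ∑ x, wt x = 1

namespace WeightedGraph

variable {V : Type*} [Fintype V]

/-- The sum `∑_{xy ∈ E} c_{xy} F(x, y)` over unordered edges, for `F` symmetric in `x` and `y`:
one half of the sum over ordered pairs. -/
def edgeSum {A : Type*} [AddCommGroup A] [Module ℝ A] (G : WeightedGraph V) (F : V → V → A) : A :=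
  (1 / 2 : ℝ) • ∑ x, ∑ y, G.cond x y • F x y

/-- The norm of `L^p(V, π)`, for finite `p`. -/
def lpNorm (G : WeightedGraph V) (p : ℝ) (ψ : V → ℝ) : ℝ :=
  (∑ x, G.wt x * |ψ x| ^ p) ^ (1 / p)

section SingleParticle

variable [DecidableEq V]

/-- A particle which sits at `x` or `y` is placed at `x` with probability `π(x) / (π(x) + π(y))`
and at `y` otherwise; a particle elsewhere does not move. -/
def resample (G : WeightedGraph V) (x y : V) (ψ : V → ℝ) : V → ℝ := fun z =>
  if z = x ∨ z = y then
    G.wt x / (G.wt x + G.wt y) * ψ x + G.wt y / (G.wt x + G.wt y) * ψ y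
  else ψ z

/-- The generator of the single-particle Binomial Splitting process. -/
def binGenerator (G : WeightedGraph V) (ψ : V → ℝ) : V → ℝ :=
  G.edgeSum fun x y => G.resample x y ψ - ψ

/-- The spectral gap of the single-particle system, through the Rayleigh quotient. -/
def gap (G : WeightedGraph V) : ℝ :=
  sInf {r : ℝ | ∃ ψ : V → ℝ, ψ ≠ 0 ∧ ∑ x, G.wt x * ψ x = 0 ∧
    r = (∑ x, G.wt x * (ψ x * (-G.binGenerator ψ x))) / ∑ x, G.wt x * ψ x ^ 2}

/-- The relaxation time. -/
def tRel (G : WeightedGraph V) : ℝ := G.gap⁻¹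

end SingleParticle

/-- The Dirichlet form of the single-particle system. -/
def dirichletForm (G : WeightedGraph V) (ψ : V → ℝ) : ℝ :=
  G.edgeSum fun x y => G.wt x * G.wt y / (G.wt x + G.wt y) * (ψ x - ψ y) ^ 2

/-- The Nash inequality for the single-particle system with constants `d`, `tNash`, `T`. -/
def Nash (G : WeightedGraph V) (d tNash T : ℝ) : Prop :=
  ∀ ψ : V → ℝ, G.lpNorm 2 ψ ^ (2 * (1 + 2 / d)) ≤
    tNash * (G.dirichletForm ψ + T⁻¹ * G.lpNorm 2 ψ ^ 2) * G.lpNorm 1 ψ ^ (4 / d)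

section Averaging

variable [DecidableEq V]

/-- The configuration `η^{xy}`: the total mass at `x` and `y` is redistributed between `x` and `y`
proportionally to their site-weights. -/
def splitFun (G : WeightedGraph V) (x y : V) (η : V → ℝ) : V → ℝ := fun z =>
  if z = x then G.wt x / (G.wt x + G.wt y) * (η x + η y)
  else if z = y then G.wt y / (G.wt x + G.wt y) * (η x + η y)
  else η z

theorem splitFun_mem (G : WeightedGraph V) (x y : V) {η : V → ℝ} (hη : η ∈ stdSimplex ℝ V) :
    G.splitFun x y η ∈ stdSimplex ℝ V := by
  have hx := G.wt_pos x
  have hy := G.wt_pos y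
  refine ⟨fun z => ?_, ?_⟩
  · have h1 := hη.1 x
    have h2 := hη.1 y
    have h3 := hη.1 z
    unfold splitFun
    split_ifs <;> positivity
  · rw [← hη.2]
    by_cases hxy : x = y
    · subst hxy
      refine Finset.sum_congr rfl fun z _ => ?_
      unfold splitFun
      split_ifs with h
      · subst h
        field_simp
      · rfl
    · have key : ∀ f : V → ℝ, ∑ z, f z = f x + (f y + ∑ z ∈ (Finset.univ.erase x).erase y, f z) := by
        intro f
        rw [Finset.add_sum_erase _ _ (by simp [Ne.symm hxy]),
          Finset.add_sum_erase _ _ (Finset.mem_univ x)]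
      rw [key, key η]
      have hrest : ∑ z ∈ (Finset.univ.erase x).erase y, G.splitFun x y η z
          = ∑ z ∈ (Finset.univ.erase x).erase y, η z := by
        refine Finset.sum_congr rfl fun z hz => ?_
        simp only [Finset.mem_erase, Finset.mem_univ, and_true] at hz
        simp [splitFun, hz.1, hz.2]
      rw [hrest]
      simp only [splitFun, if_true, if_neg (Ne.symm hxy)]
      field_simp
      ring

/-- `η ↦ η^{xy}` as a continuous self-map of the simplex `Δ` of probabilities on `V`. -/
def split (G : WeightedGraph V) (x y : V) : C(stdSimplex ℝ V, stdSimplex ℝ V) where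
  toFun η := ⟨G.splitFun x y η.1, G.splitFun_mem x y η.2⟩
  continuous_toFun := by
    refine Continuous.subtype_mk (continuous_pi fun z => ?_) _
    have h : ∀ w, Continuous fun η : stdSimplex ℝ V => η.1 w :=
      fun w => (continuous_apply w).comp continuous_subtype_val
    unfold splitFun
    split_ifs
    · exact continuous_const.mul ((h x).add (h y))
    · exact continuous_const.mul ((h x).add (h y))
    · exact h z

/-- The generator of the Averaging process, the bounded operator
`f ↦ ∑_{xy ∈ E} c_{xy} (f(η^{xy}) - f(η))` on the Banach space `C(Δ)`. -/
def avgGenerator (G : WeightedGraph V) : C(stdSimplex ℝ V, ℝ) →L[ℝ] C(stdSimplex ℝ V, ℝ) :=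
  G.edgeSum fun x y => ContinuousMap.compCLM ℝ ℝ (G.split x y) - ContinuousLinearMap.id ℝ _

/-- The Feller semigroup `S_t = exp(t L)` of the Averaging process, which is the Markov process on
`Δ` with generator `L`. -/
def avgSemigroup (G : WeightedGraph V) (t : ℝ) :
    C(stdSimplex ℝ V, ℝ) →L[ℝ] C(stdSimplex ℝ V, ℝ) :=
  expSemigroup G.avgGenerator t

/-- The expectation `E_η[f(η_t)] = (S_t f)(η)` for the Averaging process started from `η`. -/
def avgExpect (G : WeightedGraph V) (η : stdSimplex ℝ V) (t : ℝ) (f : C(stdSimplex ℝ V, ℝ)) : ℝ :=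
  G.avgSemigroup t f η

end Averaging

/-- The observable `η ↦ ‖η / π - 1‖_p` on the simplex. -/
def lpDist (G : WeightedGraph V) (p : ℝ) (hp : 0 ≤ p) : C(stdSimplex ℝ V, ℝ) where
  toFun η := G.lpNorm p fun x => η.1 x / G.wt x - 1
  continuous_toFun := by
    have h : ∀ w, Continuous fun η : stdSimplex ℝ V => η.1 w :=
      fun w => (continuous_apply w).comp continuous_subtype_val
    unfold lpNorm
    refine Continuous.rpow_const ?_ fun _ => Or.inr (by positivity)
    refine continuous_finsetSum _ fun x _ => continuous_const.mul ?_
    exact Continuous.rpow_const (((h x).div_const _).sub continuous_const).abs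
      fun _ => Or.inr hp

/-- The worst-case distance to equilibrium `sup_{η ∈ Δ} E_η[‖η_t / π - 1‖_p]`. -/
def avgWorstDist [DecidableEq V] (G : WeightedGraph V) (p : ℝ) (hp : 0 ≤ p) (t : ℝ) : ℝ :=
  ⨆ η : stdSimplex ℝ V, G.avgExpect η t (G.lpDist p hp)

/-- The time `t_mix + s * t_rel`, where `t_mix = (t_rel / 2) log k`. -/
def cutoffTime [DecidableEq V] (G : WeightedGraph V) (k : ℕ) (s : ℝ) : ℝ :=
  G.tRel / 2 * Real.log k + s * G.tRel

end WeightedGraph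

/-- Finite-dimensional geometries: Nash inequalities hold with positive constants such that
`d = O(1)`, `tNash = O(t_rel)` and `T = Θ(tNash)`. -/
def FiniteDimensionalGeometry {V : ℕ+ → Type*} [∀ n, Fintype (V n)] [∀ n, DecidableEq (V n)]
    (G : ∀ n, WeightedGraph (V n)) : Prop :=
  ∃ d tNash T : ℕ+ → ℝ,
    (∀ n, 0 < d n ∧ 0 < tNash n ∧ 0 < T n ∧ (G n).Nash (d n) (tNash n) (T n)) ∧
    d =O[atTop] (fun _ => (1 : ℝ)) ∧
    tNash =O[atTop] (fun n => (G n).tRel) ∧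
    T =Θ[atTop] tNash

/-- Uniformly elliptic site-weights: `max π / min π` is bounded uniformly in `n`. -/
def UniformlyElliptic {V : ℕ+ → Type*} [∀ n, Fintype (V n)]
    (G : ∀ n, WeightedGraph (V n)) : Prop :=
  ∃ cEll : ℝ, 1 ≤ cEll ∧ ∀ n x y, (G n).wt x ≤ cEll * (G n).wt y

end

/-! Write h_t = η_t/π - 1. An edge update acts on h as the orthogonal projection P_xy of L²(π)
(`fluct_split`), and for p ≤ 2 the upper bound follows from one on the second moment w(t) =
E‖h_t‖₂². Since w' = -E[𝓔(h)] (`avgGenerator_heatSq_zero`), the gap alone yields only w(t) ≤ e^{-gap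
t} w(0), half the required rate.

The mean of h_t is P_t h_0, with P_t the single-particle semigroup, and its squared norm does decay
at rate 2 gap. What separates it from w is noise: E‖P_{t-s} h_s‖² has s-derivative E ∑ c_xy
‖P_{t-s}(P_xy h_s - h_s)‖², and interpolates between ‖P_t h_0‖² and w(t). Each increment P_xy h - h
is a multiple of a dipole δ_x - δ_y. Once the chain has run for b = t_rel/4, a dipole has bounded
norm, whereas initially its squared norm is at least 2/m with m ≥ max π; so older noise is damped by
a factor of order m (`normSq_heat_dipole_le`). Noise from the last stretch of length b is charged to
w(t-b) - w(t). The resulting recursion (`two_mul_avgExpect_heatSq_le`) closes to w(t) ≤ 3(e^{-2 gap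
t} + 12Km e^{-gap t}) w(0) (`avgExpect_heatSq_le`). By ellipticity m = O(1/n), so k = O(n²) makes
both terms O(e^{-C}/k) at t⁺(C).

The Nash inequality supplies K, a bound on w(t_rel/4) uniform in n and in the start
(`avgExpect_heatSq_le_of_nash`). It removes the dependence on w(0) and gives the dipole bound.

For the lower bound, test h_t against a gap eigenfunction ψ with ‖ψ‖₂ = 1. The same K gives ‖ψ‖_∞ ≤
K + 1; starting from π(1 + ψ/‖ψ‖_∞), the expectation of ⟨h_t, ψ⟩ is e^{-gap t}/‖ψ‖_∞, of order
e^C/√k at t⁻(C) (`exp_le_mul_avgWorstDist`). -/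

section ExpSemigroup

/-! ### Exponentials of bounded operators -/

variable {E : Type*} [NormedAddCommGroup E] [NormedSpace ℝ E]

theorem expSemigroup_zero (A : E →L[ℝ] E) : expSemigroup A 0 = 1 := by
  simp [expSemigroup]

theorem expSemigroup_comm (A : E →L[ℝ] E) (t : ℝ) (f : E) :
    expSemigroup A t (A f) = A (expSemigroup A t f) :=
  congrArg (fun B : E →L[ℝ] E => B f)
    ((Commute.refl A).smul_left t).exp_left.eq

variable [CompleteSpace E]

theorem expSemigroup_add (A : E →L[ℝ] E) (s t : ℝ) :
    expSemigroup A (s + t) = expSemigroup A s * expSemigroup A t := by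
  let _ : NormedAlgebra ℚ (E →L[ℝ] E) := NormedAlgebra.restrictScalars ℚ ℝ _
  unfold expSemigroup
  rw [add_smul, NormedSpace.exp_add_of_commute]
  exact (Commute.refl A).smul_left s |>.smul_right t

theorem hasDerivAt_expSemigroup (A : E →L[ℝ] E) (t : ℝ) :
    HasDerivAt (expSemigroup A) (expSemigroup A t * A) t :=
  hasDerivAt_exp_smul_const A t

theorem hasDerivAt_expSemigroup_apply (A : E →L[ℝ] E) (f : E) (t : ℝ) :
    HasDerivAt (fun t => expSemigroup A t f) (expSemigroup A t (A f)) t := by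
  simpa using (hasDerivAt_expSemigroup A t).clm_apply (hasDerivAt_const t f)

theorem expSemigroup_apply_of_eigenvector (A : E →L[ℝ] E) {f : E} {μ : ℝ} (hf : A f = μ • f)
    (t : ℝ) : expSemigroup A t f = Real.exp (t * μ) • f := by
  have hd : ∀ t, HasDerivAt (fun t => Real.exp (-(t * μ)) • expSemigroup A t f) 0 t := by
    intro t
    have h1 : HasDerivAt (fun t => Real.exp (-(t * μ))) (Real.exp (-(t * μ)) * (-(1 * μ))) t :=
      (((hasDerivAt_id t).mul_const μ).neg).exp
    refine (h1.smul (hasDerivAt_expSemigroup_apply A f t)).congr_deriv ?_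
    rw [hf, map_smul]
    module
  have hc := is_const_of_deriv_eq_zero (fun t => (hd t).differentiableAt)
    (fun t => (hd t).deriv) t 0
  simp only [zero_mul, neg_zero, Real.exp_zero, one_smul, expSemigroup_zero,
    one_apply_eq_self] at hc
  conv_rhs => rw [← hc]
  rw [smul_smul, ← Real.exp_add]
  simp

/-- If `A + c` preserves the cone where all functionals in `Λ` are nonnegative, so does `exp(tA)`
for `t ≥ 0`. -/
theorem expSemigroup_nonneg (A : E →L[ℝ] E) (c : ℝ) (Λ : Set (E →L[ℝ] ℝ))
    (hA : ∀ f : E, (∀ φ ∈ Λ, 0 ≤ φ f) → ∀ φ ∈ Λ, 0 ≤ φ (A f) + c * φ f)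
    {t : ℝ} (ht : 0 ≤ t) {f : E} (hf : ∀ φ ∈ Λ, 0 ≤ φ f) {φ : E →L[ℝ] ℝ} (hφ : φ ∈ Λ) :
    0 ≤ φ (expSemigroup A t f) := by
  let _ : NormedAlgebra ℚ (E →L[ℝ] E) := NormedAlgebra.restrictScalars ℚ ℝ _
  -- Uniformization: exp(tA) = e^{-tc} exp(tB), and all powers of B preserve the cone, so the
  -- exponential series has nonnegative terms.
  set B : E →L[ℝ] E := A + c • 1 with hB
  have hpow : ∀ n : ℕ, ∀ φ ∈ Λ, 0 ≤ φ ((B ^ n) f) := by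
    intro n
    induction n with
    | zero => simpa using hf
    | succ n ih =>
      intro φ hφ
      rw [pow_succ']
      simpa [hB] using hA _ ih φ hφ
  have hexp : expSemigroup A t = Real.exp (-(t * c)) • NormedSpace.exp (t • B) := by
    unfold expSemigroup
    have h1 : t • A = t • B + algebraMap ℝ (E →L[ℝ] E) (-(t * c)) := by
      rw [Algebra.algebraMap_eq_smul_one, hB]
      module
    rw [h1, NormedSpace.exp_add_of_commute (Algebra.commutes _ _).symm,
      ← NormedSpace.algebraMap_exp_comm, Algebra.algebraMap_eq_smul_one, mul_smul_comm, mul_one,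
      Real.exp_eq_exp_ℝ]
  have hs := NormedSpace.exp_series_hasSum_exp' (𝕂 := ℝ) (t • B)
  have hs' := (hs.mapL (ContinuousLinearMap.apply ℝ E f)).mapL φ
  have h0 : 0 ≤ φ ((NormedSpace.exp (t • B)) f) := by
    refine hs'.nonneg fun n => ?_
    have := hpow n φ hφ
    simp only [ContinuousLinearMap.apply_apply, smul_pow, map_smul, smul_eq_mul]
    positivity
  rw [hexp, smul_apply, map_smul, smul_eq_mul]
  positivity

end ExpSemigroup

/-! ### Single-particle chain: L²(π) calculus and the Dirichlet form -/

noncomputable section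
namespace WeightedGraph

variable {V : Type*} [Fintype V]

theorem cond_nonneg (G : WeightedGraph V) (x y : V) : 0 ≤ G.cond x y := by
  by_cases h : G.graph.Adj x y
  · exact (G.cond_pos x y h).le
  · exact (G.cond_eq_zero x y h).ge

theorem edgeSum_nonneg (G : WeightedGraph V) {F : V → V → ℝ} (hF : ∀ x y, 0 ≤ F x y) :
    0 ≤ G.edgeSum F := by
  unfold edgeSum
  refine smul_nonneg (by norm_num) ?_
  exact Finset.sum_nonneg fun x _ => Finset.sum_nonneg fun y _ =>
    smul_nonneg (G.cond_nonneg x y) (hF x y)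

theorem edgeSum_mono (G : WeightedGraph V) {F F' : V → V → ℝ} (hF : ∀ x y, F x y ≤ F' x y) :
    G.edgeSum F ≤ G.edgeSum F' := by
  unfold edgeSum
  refine smul_le_smul_of_nonneg_left ?_ (by norm_num)
  exact Finset.sum_le_sum fun x _ => Finset.sum_le_sum fun y _ =>
    smul_le_smul_of_nonneg_left (hF x y) (G.cond_nonneg x y)

theorem map_edgeSum (G : WeightedGraph V) {A B : Type*} [AddCommGroup A] [Module ℝ A]
    [AddCommGroup B] [Module ℝ B] (φ : A →ₗ[ℝ] B) (F : V → V → A) :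
    φ (G.edgeSum F) = G.edgeSum fun x y => φ (F x y) := by
  simp [edgeSum, map_sum]

theorem edgeSum_add (G : WeightedGraph V) {A : Type*} [AddCommGroup A] [Module ℝ A]
    (F F' : V → V → A) : G.edgeSum (fun x y => F x y + F' x y) = G.edgeSum F + G.edgeSum F' := by
  simp [edgeSum, Finset.sum_add_distrib]

theorem edgeSum_smul (G : WeightedGraph V) {A : Type*} [AddCommGroup A] [Module ℝ A]
    (c : ℝ) (F : V → V → A) : G.edgeSum (fun x y => c • F x y) = c • G.edgeSum F := by
  simp only [edgeSum, Finset.smul_sum]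
  refine Finset.sum_congr rfl fun x _ => Finset.sum_congr rfl fun y _ => ?_
  module

theorem edgeSum_const_mul (G : WeightedGraph V) (c : ℝ) (F : V → V → ℝ) :
    G.edgeSum (fun x y => c * F x y) = c * G.edgeSum F :=
  G.edgeSum_smul c F

theorem edgeSum_zero (G : WeightedGraph V) {A : Type*} [AddCommGroup A] [Module ℝ A] :
    G.edgeSum (fun _ _ => (0 : A)) = 0 := by
  simp [edgeSum]

/-- The inner product of `L²(V, π)`. -/
def wtInner (G : WeightedGraph V) (φ ψ : V → ℝ) : ℝ := ∑ x, G.wt x * (φ x * ψ x)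

/-- The squared norm of `L²(V, π)`. -/
def normSq (G : WeightedGraph V) (ψ : V → ℝ) : ℝ := ∑ x, G.wt x * ψ x ^ 2

theorem wtInner_self (G : WeightedGraph V) (ψ : V → ℝ) : G.wtInner ψ ψ = G.normSq ψ := by
  simp [wtInner, normSq, sq]

theorem wtInner_comm (G : WeightedGraph V) (φ ψ : V → ℝ) : G.wtInner φ ψ = G.wtInner ψ φ := by
  simp [wtInner, mul_comm]

/-- `φ ↦ ⟨φ, ψ⟩` as a linear functional. -/
def wtInnerLeft (G : WeightedGraph V) (φ : V → ℝ) : (V → ℝ) →ₗ[ℝ] ℝ where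
  toFun ψ := G.wtInner φ ψ
  map_add' ψ ψ' := by
    simp [wtInner, mul_add, Finset.sum_add_distrib]
  map_smul' c ψ := by
    simp only [wtInner, Pi.smul_apply, smul_eq_mul, RingHom.id_apply, Finset.mul_sum]
    exact Finset.sum_congr rfl fun x _ => by ring

theorem wtInner_add_right (G : WeightedGraph V) (φ ψ ψ' : V → ℝ) :
    G.wtInner φ (ψ + ψ') = G.wtInner φ ψ + G.wtInner φ ψ' := (G.wtInnerLeft φ).map_add ψ ψ'

theorem wtInner_sub_right (G : WeightedGraph V) (φ ψ ψ' : V → ℝ) :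
    G.wtInner φ (ψ - ψ') = G.wtInner φ ψ - G.wtInner φ ψ' := (G.wtInnerLeft φ).map_sub ψ ψ'

theorem wtInner_smul_right (G : WeightedGraph V) (c : ℝ) (φ ψ : V → ℝ) :
    G.wtInner φ (c • ψ) = c * G.wtInner φ ψ := (G.wtInnerLeft φ).map_smul c ψ

theorem normSq_nonneg (G : WeightedGraph V) (ψ : V → ℝ) : 0 ≤ G.normSq ψ :=
  Finset.sum_nonneg fun x _ => mul_nonneg (G.wt_pos x).le (sq_nonneg _)

theorem normSq_eq_zero (G : WeightedGraph V) {ψ : V → ℝ} (h : G.normSq ψ = 0) : ψ = 0 := by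
  unfold normSq at h
  rw [Finset.sum_eq_zero_iff_of_nonneg
    fun x _ => mul_nonneg (G.wt_pos x).le (sq_nonneg _)] at h
  funext x
  have := h x (Finset.mem_univ x)
  simpa [(G.wt_pos x).ne'] using this

theorem normSq_pos (G : WeightedGraph V) {ψ : V → ℝ} (h : ψ ≠ 0) : 0 < G.normSq ψ :=
  (G.normSq_nonneg ψ).lt_of_ne fun h0 => h (G.normSq_eq_zero h0.symm)

theorem normSq_smul (G : WeightedGraph V) (c : ℝ) (ψ : V → ℝ) :
    G.normSq (c • ψ) = c ^ 2 * G.normSq ψ := by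
  simp only [normSq, Pi.smul_apply, smul_eq_mul, Finset.mul_sum]
  exact Finset.sum_congr rfl fun x _ => by ring

theorem normSq_add (G : WeightedGraph V) (φ ψ : V → ℝ) :
    G.normSq (φ + ψ) = G.normSq φ + 2 * G.wtInner φ ψ + G.normSq ψ := by
  simp only [normSq, wtInner, Pi.add_apply, Finset.mul_sum, ← Finset.sum_add_distrib]
  exact Finset.sum_congr rfl fun x _ => by ring

theorem normSq_sub_le (G : WeightedGraph V) (φ ψ : V → ℝ) :
    G.normSq (φ - ψ) ≤ 2 * (G.normSq φ + G.normSq ψ) := by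
  simp only [normSq, Pi.sub_apply, Finset.mul_sum, ← Finset.sum_add_distrib]
  refine Finset.sum_le_sum fun x _ => ?_
  nlinarith [mul_nonneg (G.wt_pos x).le (sq_nonneg (φ x + ψ x))]

theorem wtInner_one (G : WeightedGraph V) (ψ : V → ℝ) :
    G.wtInner 1 ψ = ∑ x, G.wt x * ψ x := by
  simp [wtInner]

variable [DecidableEq V]

/-- `P_{xy}` as a linear map. -/
def resampleLin (G : WeightedGraph V) (x y : V) : (V → ℝ) →ₗ[ℝ] (V → ℝ) where
  toFun := G.resample x y
  map_add' φ ψ := by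
    funext z
    simp only [resample, Pi.add_apply]
    split_ifs <;> ring
  map_smul' c ψ := by
    funext z
    simp only [resample, Pi.smul_apply, smul_eq_mul, RingHom.id_apply]
    split_ifs <;> ring

/-- The generator of the single-particle system as a continuous linear map. -/
def genCLM (G : WeightedGraph V) : (V → ℝ) →L[ℝ] (V → ℝ) :=
  LinearMap.toContinuousLinearMap (G.edgeSum fun x y => G.resampleLin x y - LinearMap.id)

theorem genCLM_apply (G : WeightedGraph V) (ψ : V → ℝ) : G.genCLM ψ = G.binGenerator ψ :=
  G.map_edgeSum (LinearMap.applyₗ (R := ℝ) ψ) fun x y => G.resampleLin x y - LinearMap.id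

/-- The signed measure `δ_x - δ_y` as a density with respect to `π`. -/
def dipole (G : WeightedGraph V) (x y : V) : V → ℝ :=
  fun z => (if z = x then (G.wt x)⁻¹ else 0) - (if z = y then (G.wt y)⁻¹ else 0)

/-- Resampling an edge only moves π-mass between its endpoints. This is what makes the noise of the
process a combination of dipoles. -/
theorem resample_sub_self (G : WeightedGraph V) (x y : V) (ψ : V → ℝ) :
    G.resample x y ψ - ψ =
      (G.wt x * G.wt y / (G.wt x + G.wt y) * (ψ y - ψ x)) • G.dipole x y := by
  have hx := G.wt_pos x
  have hy := G.wt_pos y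
  funext z
  simp only [resample, dipole, Pi.sub_apply, Pi.smul_apply, smul_eq_mul]
  by_cases h1 : z = x <;> by_cases h2 : z = y
  · subst h1; subst h2; simp; field_simp; ring
  · subst h1; simp [h2]; field_simp; ring
  · subst h2; simp [h1]; field_simp; ring
  · simp [h1, h2]

theorem wtInner_dipole (G : WeightedGraph V) (x y : V) (φ : V → ℝ) :
    G.wtInner φ (G.dipole x y) = φ x - φ y := by
  have hx := (G.wt_pos x).ne'
  have hy := (G.wt_pos y).ne'
  simp only [wtInner, dipole, mul_sub, mul_ite, mul_zero, Finset.sum_sub_distrib,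
    Finset.sum_ite_eq', Finset.mem_univ, if_true]
  field_simp

theorem normSq_dipole (G : WeightedGraph V) {x y : V} (hxy : x ≠ y) :
    G.normSq (G.dipole x y) = (G.wt x)⁻¹ + (G.wt y)⁻¹ := by
  rw [← wtInner_self, wtInner_dipole]
  simp [dipole, hxy, hxy.symm]

theorem wtInner_resample_sub (G : WeightedGraph V) (x y : V) (φ ψ : V → ℝ) :
    G.wtInner φ (G.resample x y ψ - ψ) =
      -(G.wt x * G.wt y / (G.wt x + G.wt y) * ((φ x - φ y) * (ψ x - ψ y))) := by
  rw [resample_sub_self, wtInner_smul_right, wtInner_dipole]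
  ring

theorem normSq_resample_sub (G : WeightedGraph V) (x y : V) (ψ : V → ℝ) :
    G.normSq (G.resample x y ψ - ψ) =
      G.wt x * G.wt y / (G.wt x + G.wt y) * (ψ x - ψ y) ^ 2 := by
  have hx := G.wt_pos x
  have hy := G.wt_pos y
  rw [resample_sub_self, normSq_smul]
  by_cases hxy : x = y
  · subst hxy; simp
  · rw [normSq_dipole G hxy]
    field_simp
    ring

/-- P_xy is an orthogonal projection, so ⟨ψ, ψ - P_xy ψ⟩ = ‖P_xy ψ - ψ‖². The Dirichlet form thus
measures both dissipation and the size of the noise, which lets noise be paid for by the decrease of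
the second moment. -/
theorem dirichletForm_eq (G : WeightedGraph V) (ψ : V → ℝ) :
    G.dirichletForm ψ = G.edgeSum fun x y => G.normSq (G.resample x y ψ - ψ) := by
  simp only [dirichletForm, normSq_resample_sub]

theorem dirichletForm_nonneg (G : WeightedGraph V) (ψ : V → ℝ) : 0 ≤ G.dirichletForm ψ := by
  rw [dirichletForm_eq]
  exact G.edgeSum_nonneg fun x y => G.normSq_nonneg _

theorem wtInner_binGenerator (G : WeightedGraph V) (φ ψ : V → ℝ) :
    G.wtInner φ (G.binGenerator ψ) = -G.edgeSum fun x y =>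
      G.wt x * G.wt y / (G.wt x + G.wt y) * ((φ x - φ y) * (ψ x - ψ y)) := by
  refine (G.map_edgeSum (G.wtInnerLeft φ) _).trans ?_
  rw [← neg_one_mul, ← edgeSum_const_mul]
  congr 1
  funext x y
  exact (G.wtInner_resample_sub x y φ ψ).trans (neg_one_mul _).symm

theorem wtInner_binGenerator_comm (G : WeightedGraph V) (φ ψ : V → ℝ) :
    G.wtInner φ (G.binGenerator ψ) = G.wtInner ψ (G.binGenerator φ) := by
  rw [wtInner_binGenerator, wtInner_binGenerator]
  congr 2
  funext x y
  ring

theorem wtInner_binGenerator_self (G : WeightedGraph V) (ψ : V → ℝ) :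
    G.wtInner ψ (G.binGenerator ψ) = -G.dirichletForm ψ := by
  rw [wtInner_binGenerator, dirichletForm]
  congr 2
  funext x y
  ring

theorem wtInner_one_binGenerator (G : WeightedGraph V) (ψ : V → ℝ) :
    G.wtInner 1 (G.binGenerator ψ) = 0 := by
  rw [wtInner_binGenerator]
  simp [edgeSum]

theorem gap_set_eq (G : WeightedGraph V) :
    {r : ℝ | ∃ ψ : V → ℝ, ψ ≠ 0 ∧ ∑ x, G.wt x * ψ x = 0 ∧
    r = (∑ x, G.wt x * (ψ x * (-G.binGenerator ψ x))) / ∑ x, G.wt x * ψ x ^ 2} =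
    {r : ℝ | ∃ ψ : V → ℝ, ψ ≠ 0 ∧ G.wtInner 1 ψ = 0 ∧
      r = G.dirichletForm ψ / G.normSq ψ} := by
  have h : ∀ ψ : V → ℝ, ∑ x, G.wt x * (ψ x * (-G.binGenerator ψ x)) = G.dirichletForm ψ := by
    intro ψ
    rw [← neg_neg (G.dirichletForm ψ), ← wtInner_binGenerator_self]
    simp [wtInner]
  simp only [h, wtInner_one, normSq]

theorem gap_mul_normSq_le (G : WeightedGraph V) {ψ : V → ℝ} (hψ : G.wtInner 1 ψ = 0) :
    G.gap * G.normSq ψ ≤ G.dirichletForm ψ := by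
  by_cases h0 : ψ = 0
  · subst h0
    have : G.normSq 0 = 0 := by simp [normSq]
    rw [this, mul_zero]
    exact G.dirichletForm_nonneg 0
  · rw [← le_div_iff₀ (G.normSq_pos h0), gap, gap_set_eq]
    refine csInf_le ⟨0, ?_⟩ ⟨ψ, h0, hψ, rfl⟩
    rintro r ⟨φ, -, -, rfl⟩
    exact div_nonneg (G.dirichletForm_nonneg φ) (G.normSq_nonneg φ)

end WeightedGraph
end

/-! ### Spectral gap, eigenfunction and heat semigroup -/

noncomputable section
namespace WeightedGraph

variable {V : Type*} [Fintype V]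

theorem continuous_normSq (G : WeightedGraph V) : Continuous G.normSq := by
  unfold normSq
  fun_prop

theorem continuous_dirichletForm (G : WeightedGraph V) : Continuous G.dirichletForm := by
  unfold dirichletForm edgeSum
  fun_prop

theorem continuous_wtInner (G : WeightedGraph V) (φ : V → ℝ) : Continuous (G.wtInner φ) := by
  unfold wtInner
  fun_prop

theorem dirichletForm_smul (G : WeightedGraph V) (c : ℝ) (ψ : V → ℝ) :
    G.dirichletForm (c • ψ) = c ^ 2 * G.dirichletForm ψ := by
  unfold dirichletForm
  rw [← edgeSum_const_mul]
  congr 1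
  funext x y
  simp only [Pi.smul_apply, smul_eq_mul]
  ring

theorem eq_of_dirichletForm_eq_zero (G : WeightedGraph V) {ψ : V → ℝ}
    (h : G.dirichletForm ψ = 0) (x y : V) : ψ x = ψ y := by
  have hterm : ∀ x y, 0 ≤ G.cond x y • (G.wt x * G.wt y / (G.wt x + G.wt y) *
      (ψ x - ψ y) ^ 2) := fun x y => by
    have := G.wt_pos x
    have := G.wt_pos y
    have := G.cond_nonneg x y
    rw [smul_eq_mul]
    positivity
  have hadj : ∀ x y, G.graph.Adj x y → ψ x = ψ y := by
    intro x y hxy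
    unfold dirichletForm edgeSum at h
    rw [smul_eq_zero_iff_right (by norm_num), Finset.sum_eq_zero_iff_of_nonneg
      fun x _ => Finset.sum_nonneg fun y _ => hterm x y] at h
    have h1 := h x (Finset.mem_univ x)
    rw [Finset.sum_eq_zero_iff_of_nonneg fun y _ => hterm x y] at h1
    have h2 := h1 y (Finset.mem_univ y)
    have hx := G.wt_pos x
    have hy := G.wt_pos y
    have hc := G.cond_pos x y hxy
    have h3 : G.wt x * G.wt y / (G.wt x + G.wt y) ≠ 0 := by positivity
    have h4 : (ψ x - ψ y) ^ 2 = 0 := by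
      simpa [hc.ne', h3] using h2
    exact sub_eq_zero.mp (pow_eq_zero_iff (two_ne_zero) |>.mp h4)
  obtain ⟨w⟩ := G.connected.preconnected x y
  induction w with
  | nil => rfl
  | cons hab _ ih => exact (hadj _ _ hab).trans ih

theorem exists_normSq_eq_one (G : WeightedGraph V) {ψ : V → ℝ} (h0 : ψ ≠ 0)
    (h1 : G.wtInner 1 ψ = 0) : ∃ φ : V → ℝ, G.normSq φ = 1 ∧ G.wtInner 1 φ = 0 ∧
      G.dirichletForm φ = G.dirichletForm ψ / G.normSq ψ := by
  have hpos := G.normSq_pos h0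
  have hs : (√(G.normSq ψ))⁻¹ ^ 2 = (G.normSq ψ)⁻¹ := by
    rw [inv_pow, Real.sq_sqrt hpos.le]
  refine ⟨(√(G.normSq ψ))⁻¹ • ψ, ?_, ?_, ?_⟩
  · rw [normSq_smul, hs, inv_mul_cancel₀ hpos.ne']
  · rw [wtInner_smul_right, h1, mul_zero]
  · rw [dirichletForm_smul, hs, div_eq_inv_mul]

theorem hasDerivAt_normSq (G : WeightedGraph V) {f : ℝ → V → ℝ} {f' : V → ℝ} {t : ℝ}
    (hf : HasDerivAt f f' t) :
    HasDerivAt (fun t => G.normSq (f t)) (2 * G.wtInner (f t) f') t := by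
  have h : ∀ x, HasDerivAt (fun t => f t x) (f' x) t := hasDerivAt_pi.mp hf
  refine (HasDerivAt.fun_sum fun x _ => ((h x).pow 2).const_mul (G.wt x)).congr_deriv ?_
  rw [wtInner, Finset.mul_sum]
  refine Finset.sum_congr rfl fun x _ => ?_
  simp
  ring

variable [DecidableEq V]

theorem gap_nonneg (G : WeightedGraph V) : 0 ≤ G.gap := by
  rw [gap, gap_set_eq]
  refine Real.sInf_nonneg ?_
  rintro r ⟨φ, -, -, rfl⟩
  exact div_nonneg (G.dirichletForm_nonneg φ) (G.normSq_nonneg φ)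

/-- Compactness of the unit sphere of mean-zero functions; with at least two vertices it is
nonempty, as a normalised dipole shows. -/
theorem exists_dirichletForm_eq_gap (G : WeightedGraph V) [Nontrivial V] :
    ∃ ψ : V → ℝ, G.normSq ψ = 1 ∧ G.wtInner 1 ψ = 0 ∧ G.dirichletForm ψ = G.gap := by
  have hcomp : IsCompact {ψ : V → ℝ | G.normSq ψ = 1 ∧ G.wtInner 1 ψ = 0} := by
    refine Metric.isCompact_of_isClosed_isBounded ?_ ?_
    · exact (isClosed_eq G.continuous_normSq continuous_const).inter
        (isClosed_eq (G.continuous_wtInner 1) continuous_const)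
    · refine (Metric.isBounded_iff_subset_closedBall 0).mpr ⟨∑ x, (G.wt x)⁻¹ + 1, ?_⟩
      rintro ψ ⟨h1, -⟩
      have hsum : ∀ x, 0 ≤ (G.wt x)⁻¹ := fun x => (inv_pos.mpr (G.wt_pos x)).le
      rw [mem_closedBall_zero_iff, pi_norm_le_iff_of_nonneg
        (add_nonneg (Finset.sum_nonneg fun x _ => hsum x) zero_le_one)]
      intro x
      have h2 : G.wt x * ψ x ^ 2 ≤ 1 := by
        rw [← h1]
        exact Finset.single_le_sum (f := fun x => G.wt x * ψ x ^ 2)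
          (fun x _ => mul_nonneg (G.wt_pos x).le (sq_nonneg _)) (Finset.mem_univ x)
      have h3 : ψ x ^ 2 ≤ (G.wt x)⁻¹ := by
        rw [← one_div, le_div_iff₀ (G.wt_pos x)]
        linarith
      have h4 : (G.wt x)⁻¹ ≤ ∑ x, (G.wt x)⁻¹ :=
        Finset.single_le_sum (fun x _ => hsum x) (Finset.mem_univ x)
      rw [Real.norm_eq_abs]
      nlinarith [sq_abs (ψ x), sq_nonneg (|ψ x| - 1), abs_nonneg (ψ x)]
  obtain ⟨x, y, hxy⟩ := exists_pair_ne V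
  have hne : {ψ : V → ℝ | G.normSq ψ = 1 ∧ G.wtInner 1 ψ = 0}.Nonempty := by
    have h0 : G.dipole x y ≠ 0 := by
      intro h
      have := congrFun h x
      simp [dipole, hxy, (G.wt_pos x).ne'] at this
    obtain ⟨φ, h1, h2, -⟩ := G.exists_normSq_eq_one h0 (by simp [wtInner_dipole])
    exact ⟨φ, h1, h2⟩
  obtain ⟨ψ, ⟨h1, h2⟩, hmin⟩ := hcomp.exists_isMinOn hne G.continuous_dirichletForm.continuousOn
  refine ⟨ψ, h1, h2, le_antisymm ?_ ?_⟩
  · rw [gap, gap_set_eq]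
    refine le_csInf ⟨_, ψ, ?_, h2, rfl⟩ ?_
    · rintro rfl
      simp [normSq] at h1
    · rintro r ⟨φ, h0, hφ, rfl⟩
      obtain ⟨φ', ha, hb, hc⟩ := G.exists_normSq_eq_one h0 hφ
      rw [← hc]
      exact hmin ⟨ha, hb⟩
  · simpa [h1] using G.gap_mul_normSq_le h2

/-- Otherwise the minimiser has zero energy, so connectedness makes it constant, and its zero mean
contradicts norm one. -/
theorem gap_pos (G : WeightedGraph V) [Nontrivial V] : 0 < G.gap := by
  obtain ⟨ψ, h1, h2, h3⟩ := G.exists_dirichletForm_eq_gap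
  refine G.gap_nonneg.lt_of_ne fun h0 => ?_
  have hc := G.eq_of_dirichletForm_eq_zero (h3.trans h0.symm)
  obtain ⟨x⟩ : Nonempty V := inferInstance
  have h4 : ψ = ψ x • 1 := by
    funext y
    simp [hc y x]
  have h5 : G.wtInner 1 ψ = ψ x := by
    conv_lhs => rw [h4]
    rw [wtInner_smul_right, wtInner_one]
    simp [G.sum_wt]
  rw [h4, ← h5, h2] at h1
  simp [normSq] at h1

/-- First variation at a minimiser: the residual Lψ + gap ψ is orthogonal to all mean-zero
functions, hence to itself. -/
theorem exists_eigenfunction (G : WeightedGraph V) [Nontrivial V] :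
    ∃ ψ : V → ℝ, G.normSq ψ = 1 ∧ G.wtInner 1 ψ = 0 ∧ G.binGenerator ψ = (-G.gap) • ψ := by
  obtain ⟨ψ, h1, h2, h3⟩ := G.exists_dirichletForm_eq_gap
  refine ⟨ψ, h1, h2, ?_⟩
  have hlin : ∀ φ : V → ℝ, G.genCLM φ = G.binGenerator φ := G.genCLM_apply
  have key : ∀ φ : V → ℝ, G.wtInner 1 φ = 0 →
      G.wtInner φ (G.binGenerator ψ + G.gap • ψ) = 0 := by
    intro φ hφ
    set b := G.wtInner φ (G.binGenerator ψ + G.gap • ψ) with hb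
    set q := G.dirichletForm φ - G.gap * G.normSq φ with hq
    -- Minimality along ψ + εφ. A nonnegative quadratic in ε without constant term has no linear
    -- term; the discriminant says so below.
    have hquad : ∀ ε : ℝ, 0 ≤ ε * ε * q - 2 * ε * b := by
      intro ε
      have h := G.gap_mul_normSq_le (ψ := ψ + ε • φ)
        (by rw [wtInner_add_right, wtInner_smul_right, h2, hφ]; ring)
      have hE : G.dirichletForm (ψ + ε • φ) = G.dirichletForm ψ
          - 2 * ε * G.wtInner φ (G.binGenerator ψ) + ε ^ 2 * G.dirichletForm φ := by
        rw [wtInner_binGenerator]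
        simp only [dirichletForm]
        rw [mul_neg, sub_neg_eq_add, ← edgeSum_const_mul, ← edgeSum_const_mul, ← edgeSum_add,
          ← edgeSum_add]
        congr 1
        funext x y
        simp only [Pi.add_apply, Pi.smul_apply, smul_eq_mul]
        ring
      rw [hE, normSq_add, normSq_smul, wtInner_smul_right, h1, h3] at h
      rw [wtInner_add_right, wtInner_smul_right, wtInner_comm G φ ψ] at hb
      rw [hb, hq]
      nlinarith
    have hd := discrim_le_zero (a := q) (b := -2 * b) (c := 0) fun ε => by
      have := hquad ε
      linarith
    simp only [discrim] at hd
    nlinarith [sq_nonneg b]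
  have hmean : G.wtInner 1 (G.binGenerator ψ + G.gap • ψ) = 0 := by
    rw [wtInner_add_right, wtInner_smul_right, h2, wtInner_one_binGenerator]
    ring
  have h0 := key _ hmean
  rw [wtInner_self] at h0
  rw [neg_smul]
  exact eq_neg_of_add_eq_zero_left (G.normSq_eq_zero h0)

/-- The semigroup of the single-particle system. -/
def heat (G : WeightedGraph V) (t : ℝ) : (V → ℝ) →L[ℝ] (V → ℝ) := expSemigroup G.genCLM t

theorem heat_zero (G : WeightedGraph V) (ψ : V → ℝ) : G.heat 0 ψ = ψ := by
  rw [heat, expSemigroup_zero]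
  rfl

theorem heat_add (G : WeightedGraph V) (s t : ℝ) (ψ : V → ℝ) :
    G.heat (s + t) ψ = G.heat s (G.heat t ψ) := by
  rw [heat, expSemigroup_add]
  rfl

theorem hasDerivAt_heat (G : WeightedGraph V) (ψ : V → ℝ) (t : ℝ) :
    HasDerivAt (fun t => G.heat t ψ) (G.binGenerator (G.heat t ψ)) t := by
  rw [← genCLM_apply]
  exact (hasDerivAt_expSemigroup_apply G.genCLM ψ t).congr_deriv (expSemigroup_comm _ _ _)

theorem heat_binGenerator (G : WeightedGraph V) (t : ℝ) (ψ : V → ℝ) :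
    G.heat t (G.binGenerator ψ) = G.binGenerator (G.heat t ψ) := by
  rw [← genCLM_apply, ← genCLM_apply]
  exact expSemigroup_comm _ _ _

theorem wtInner_one_heat (G : WeightedGraph V) (t : ℝ) (ψ : V → ℝ) :
    G.wtInner 1 (G.heat t ψ) = G.wtInner 1 ψ := by
  have hd : ∀ t, HasDerivAt (fun t => G.wtInner 1 (G.heat t ψ)) 0 t := fun t =>
    ((LinearMap.toContinuousLinearMap (G.wtInnerLeft 1)).hasFDerivAt.comp_hasDerivAt t
      (G.hasDerivAt_heat ψ t)).congr_deriv (G.wtInner_one_binGenerator _)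
  have := is_const_of_deriv_eq_zero (fun t => (hd t).differentiableAt)
    (fun t => (hd t).deriv) t 0
  simpa only [heat_zero] using this

theorem normSq_heat_le (G : WeightedGraph V) {ψ : V → ℝ} (hψ : G.wtInner 1 ψ = 0)
    {t : ℝ} (ht : 0 ≤ t) :
    G.normSq (G.heat t ψ) ≤ Real.exp (-(2 * G.gap * t)) * G.normSq ψ := by
  have hd : ∀ t, HasDerivAt (fun t => Real.exp (2 * G.gap * t) * G.normSq (G.heat t ψ))
      (Real.exp (2 * G.gap * t) *
        (2 * (G.gap * G.normSq (G.heat t ψ) - G.dirichletForm (G.heat t ψ)))) t := by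
    intro t
    have h1 : HasDerivAt (fun t => Real.exp (2 * G.gap * t))
        (Real.exp (2 * G.gap * t) * (2 * G.gap * 1)) t :=
      ((hasDerivAt_id t).const_mul (2 * G.gap)).exp
    refine (h1.mul (G.hasDerivAt_normSq (G.hasDerivAt_heat ψ t))).congr_deriv ?_
    rw [wtInner_binGenerator_self]
    ring
  have hanti : Antitone (fun t => Real.exp (2 * G.gap * t) * G.normSq (G.heat t ψ)) := by
    refine antitone_of_deriv_nonpos (fun t => (hd t).differentiableAt) fun t => ?_
    rw [(hd t).deriv]
    have := G.gap_mul_normSq_le (ψ := G.heat t ψ) (by rw [wtInner_one_heat, hψ])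
    exact mul_nonpos_of_nonneg_of_nonpos (Real.exp_pos _).le (by linarith)
  have h := hanti ht
  simp only [mul_zero, Real.exp_zero, one_mul, heat_zero] at h
  rw [Real.exp_neg, ← div_eq_inv_mul, le_div_iff₀ (Real.exp_pos _), mul_comm]
  exact h

theorem normSq_heat_le_self (G : WeightedGraph V) {ψ : V → ℝ} (hψ : G.wtInner 1 ψ = 0)
    {t : ℝ} (ht : 0 ≤ t) : G.normSq (G.heat t ψ) ≤ G.normSq ψ := by
  refine (G.normSq_heat_le hψ ht).trans (mul_le_of_le_one_left (G.normSq_nonneg ψ) ?_)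
  rw [Real.exp_le_one_iff]
  have := G.gap_nonneg
  have : 0 ≤ 2 * G.gap * t := by positivity
  linarith

end WeightedGraph
end

/-! ### Averaging process: expectations and the observable ‖P_r(η/π - 1)‖² -/

noncomputable section
namespace WeightedGraph

variable {V : Type*} [Fintype V]

/-- The density of `η` with respect to `π`, centred: `η / π - 1`. -/
def fluct (G : WeightedGraph V) (η : stdSimplex ℝ V) : V → ℝ := fun x => η.1 x / G.wt x - 1

theorem wtInner_fluct (G : WeightedGraph V) (η : stdSimplex ℝ V) (ψ : V → ℝ)
    (hψ : G.wtInner 1 ψ = 0) : G.wtInner (G.fluct η) ψ = ∑ x, η.1 x * ψ x := by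
  rw [← sub_zero (∑ x, η.1 x * ψ x), ← hψ, wtInner, wtInner, ← Finset.sum_sub_distrib]
  refine Finset.sum_congr rfl fun x _ => ?_
  have := (G.wt_pos x).ne'
  simp only [fluct, Pi.one_apply]
  field_simp

theorem wtInner_one_fluct (G : WeightedGraph V) (η : stdSimplex ℝ V) :
    G.wtInner 1 (G.fluct η) = 0 := by
  have h : ∑ x, (η.1 x - G.wt x) = 0 := by
    rw [Finset.sum_sub_distrib, η.2.2, G.sum_wt, sub_self]
  rw [← h, wtInner]
  refine Finset.sum_congr rfl fun x _ => ?_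
  have := (G.wt_pos x).ne'
  simp only [fluct, Pi.one_apply]
  field_simp

/-- The coordinate `η ↦ η(x) / π(x) - 1` as a continuous function. -/
def fluctCoord (G : WeightedGraph V) (x : V) : C(stdSimplex ℝ V, ℝ) where
  toFun η := G.fluct η x
  continuous_toFun :=
    (((continuous_apply x).comp continuous_subtype_val).div_const _).sub continuous_const

theorem fluctCoord_apply (G : WeightedGraph V) (x : V) (η : stdSimplex ℝ V) :
    G.fluctCoord x η = G.fluct η x := rfl

variable [DecidableEq V]

/-- After the split both endpoints carry the density (η(x) + η(y))/(π(x) + π(y)), the π-average of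
the old densities. Hence the process is a random product of projections acting on h. -/
theorem fluct_split (G : WeightedGraph V) (x y : V) (η : stdSimplex ℝ V) :
    G.fluct (G.split x y η) = G.resample x y (G.fluct η) := by
  have hx := G.wt_pos x
  have hy := G.wt_pos y
  funext z
  simp only [fluct, split, ContinuousMap.coe_mk, splitFun, resample]
  by_cases h1 : z = x
  · subst h1
    simp only [if_true, true_or]
    field_simp
    ring
  · by_cases h2 : z = y
    · subst h2
      simp only [if_neg h1, if_true, or_true]
      field_simp
      ring
    · simp [h1, h2]

theorem avgGenerator_apply (G : WeightedGraph V) (f : C(stdSimplex ℝ V, ℝ))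
    (η : stdSimplex ℝ V) :
    G.avgGenerator f η = G.edgeSum fun x y => f (G.split x y η) - f η :=
  G.map_edgeSum (((ContinuousMap.evalCLM ℝ η).comp
    (ContinuousLinearMap.apply ℝ C(stdSimplex ℝ V, ℝ) f)).toLinearMap) fun x y =>
      ContinuousMap.compCLM ℝ ℝ (G.split x y) - ContinuousLinearMap.id ℝ _

theorem avgSemigroup_nonneg (G : WeightedGraph V) {t : ℝ} (ht : 0 ≤ t)
    {f : C(stdSimplex ℝ V, ℝ)} (hf : ∀ η, 0 ≤ f η) (η : stdSimplex ℝ V) :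
    0 ≤ G.avgSemigroup t f η := by
  refine expSemigroup_nonneg G.avgGenerator (G.edgeSum fun _ _ => 1)
    (Set.range fun η : stdSimplex ℝ V => ContinuousMap.evalCLM ℝ η) ?_ ht (f := f) ?_
    (φ := ContinuousMap.evalCLM ℝ η) ⟨η, rfl⟩
  · rintro f hf _ ⟨η, rfl⟩
    have hf' : ∀ η, 0 ≤ f η := fun η => hf _ ⟨η, rfl⟩
    simp only [ContinuousMap.evalCLM_apply]
    rw [avgGenerator_apply, mul_comm, ← edgeSum_const_mul, ← edgeSum_add]
    exact G.edgeSum_nonneg fun x y => by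
      have := hf' (G.split x y η)
      linarith
  · rintro _ ⟨η, rfl⟩
    exact hf η

theorem avgExpect_zero (G : WeightedGraph V) (η : stdSimplex ℝ V) (f : C(stdSimplex ℝ V, ℝ)) :
    G.avgExpect η 0 f = f η := by
  rw [avgExpect, avgSemigroup, expSemigroup_zero]
  rfl

theorem avgExpect_mono (G : WeightedGraph V) (η : stdSimplex ℝ V) {t : ℝ} (ht : 0 ≤ t)
    {f g : C(stdSimplex ℝ V, ℝ)} (h : ∀ η, f η ≤ g η) :
    G.avgExpect η t f ≤ G.avgExpect η t g := by
  have := G.avgSemigroup_nonneg ht (f := g - f) (fun η => sub_nonneg.mpr (h η)) η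
  rw [map_sub] at this
  exact sub_nonneg.mp this

theorem avgExpect_nonneg (G : WeightedGraph V) (η : stdSimplex ℝ V) {t : ℝ} (ht : 0 ≤ t)
    {f : C(stdSimplex ℝ V, ℝ)} (h : ∀ η, 0 ≤ f η) : 0 ≤ G.avgExpect η t f :=
  G.avgSemigroup_nonneg ht h η

theorem avgExpect_add (G : WeightedGraph V) (η : stdSimplex ℝ V) (t : ℝ)
    (f g : C(stdSimplex ℝ V, ℝ)) :
    G.avgExpect η t (f + g) = G.avgExpect η t f + G.avgExpect η t g := by
  simp [avgExpect]

theorem avgExpect_neg (G : WeightedGraph V) (η : stdSimplex ℝ V) (t : ℝ)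
    (f : C(stdSimplex ℝ V, ℝ)) : G.avgExpect η t (-f) = -G.avgExpect η t f := by
  simp [avgExpect]

theorem avgExpect_smul (G : WeightedGraph V) (η : stdSimplex ℝ V) (t c : ℝ)
    (f : C(stdSimplex ℝ V, ℝ)) :
    G.avgExpect η t (c • f) = c * G.avgExpect η t f := by
  simp [avgExpect]

theorem avgExpect_eigenvector (G : WeightedGraph V) (η : stdSimplex ℝ V) (t : ℝ)
    {f : C(stdSimplex ℝ V, ℝ)} {μ : ℝ} (hf : G.avgGenerator f = μ • f) :
    G.avgExpect η t f = Real.exp (t * μ) * f η := by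
  rw [avgExpect, avgSemigroup, expSemigroup_apply_of_eigenvector _ hf]
  rfl

theorem avgExpect_one (G : WeightedGraph V) (η : stdSimplex ℝ V) (t : ℝ) :
    G.avgExpect η t 1 = 1 := by
  have h : G.avgGenerator 1 = (0 : ℝ) • (1 : C(stdSimplex ℝ V, ℝ)) := by
    ext η
    rw [avgGenerator_apply]
    simp [edgeSum_zero]
  rw [G.avgExpect_eigenvector η t h]
  simp

theorem avgExpect_add_time (G : WeightedGraph V) (η : stdSimplex ℝ V) (s t : ℝ)
    (f : C(stdSimplex ℝ V, ℝ)) :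
    G.avgExpect η (s + t) f = G.avgExpect η s (G.avgSemigroup t f) := by
  rw [avgExpect, avgSemigroup, expSemigroup_add]
  rfl

theorem hasDerivAt_avgExpect (G : WeightedGraph V) (η : stdSimplex ℝ V)
    (f : C(stdSimplex ℝ V, ℝ)) (t : ℝ) :
    HasDerivAt (fun t => G.avgExpect η t f) (G.avgExpect η t (G.avgGenerator f)) t :=
  (ContinuousMap.evalCLM (M := ℝ) ℝ η).hasFDerivAt.comp_hasDerivAt t
    (hasDerivAt_expSemigroup_apply G.avgGenerator f t)

theorem hasDerivAt_avgExpect_of_hasDerivAt (G : WeightedGraph V) (η : stdSimplex ℝ V)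
    {f : ℝ → C(stdSimplex ℝ V, ℝ)} {f' : C(stdSimplex ℝ V, ℝ)} {t : ℝ} (hf : HasDerivAt f f' t) :
    HasDerivAt (fun t => G.avgExpect η t (f t))
      (G.avgExpect η t (G.avgGenerator (f t) + f')) t := by
  refine ((ContinuousMap.evalCLM ℝ η).hasFDerivAt.comp_hasDerivAt t
    ((hasDerivAt_expSemigroup G.avgGenerator t).clm_apply hf)).congr_deriv ?_
  rw [avgExpect_add]
  rfl

/-- The function `η ↦ P_r(η / π - 1)(z)`. -/
def heatCoord (G : WeightedGraph V) (r : ℝ) (z : V) : C(stdSimplex ℝ V, ℝ) :=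
  ∑ x, G.heat r (Pi.single x 1) z • G.fluctCoord x

theorem linear_apply_eq_sum (A : (V → ℝ) →ₗ[ℝ] ℝ) (ψ : V → ℝ) :
    A ψ = ∑ x, A (Pi.single x 1) * ψ x := by
  conv_lhs => rw [pi_eq_sum_univ' ψ, map_sum]
  refine Finset.sum_congr rfl fun x _ => ?_
  rw [map_smul, smul_eq_mul, mul_comm]

theorem heatCoord_apply (G : WeightedGraph V) (r : ℝ) (z : V) (η : stdSimplex ℝ V) :
    G.heatCoord r z η = G.heat r (G.fluct η) z := by
  rw [heatCoord, ContinuousMap.sum_apply]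
  exact (linear_apply_eq_sum ((LinearMap.proj z).comp (G.heat r).toLinearMap) (G.fluct η)).symm

theorem hasDerivAt_heatCoord (G : WeightedGraph V) (r : ℝ) (z : V) :
    HasDerivAt (fun r => G.heatCoord r z)
      (∑ x, G.binGenerator (G.heat r (Pi.single x 1)) z • G.fluctCoord x) r :=
  HasDerivAt.fun_sum fun x _ =>
    (hasDerivAt_pi.mp (G.hasDerivAt_heat (Pi.single x 1) r) z).smul_const (G.fluctCoord x)

/-- The function `η ↦ ‖P_r(η / π - 1)‖₂²`. -/
def heatSq (G : WeightedGraph V) (r : ℝ) : C(stdSimplex ℝ V, ℝ) :=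
  ∑ z, G.wt z • (G.heatCoord r z * G.heatCoord r z)

theorem heatSq_apply (G : WeightedGraph V) (r : ℝ) (η : stdSimplex ℝ V) :
    G.heatSq r η = G.normSq (G.heat r (G.fluct η)) := by
  simp [heatSq, normSq, heatCoord_apply, sq]

theorem heatSq_zero_apply (G : WeightedGraph V) (η : stdSimplex ℝ V) :
    G.heatSq 0 η = G.normSq (G.fluct η) := by
  rw [heatSq_apply, heat_zero]

/-- The derivative is taken in the norm of C(Δ), so that it can be combined with the derivative of
the operator semigroup; its values suffice afterwards. -/
theorem exists_hasDerivAt_heatSq (G : WeightedGraph V) (r : ℝ) :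
    ∃ F : C(stdSimplex ℝ V, ℝ), HasDerivAt G.heatSq F r ∧
      ∀ η, F η = 2 * G.wtInner (G.heat r (G.fluct η)) (G.binGenerator (G.heat r (G.fluct η))) := by
  have h := fun z => G.hasDerivAt_heatCoord r z
  refine ⟨_, HasDerivAt.fun_sum fun z _ => (((h z).mul (h z)).const_smul (G.wt z)), fun η => ?_⟩
  have h2 : ∀ z, (∑ x, G.binGenerator (G.heat r (Pi.single x 1)) z • G.fluctCoord x) η =
      G.binGenerator (G.heat r (G.fluct η)) z := by
    intro z
    rw [ContinuousMap.sum_apply, ← genCLM_apply]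
    refine Eq.trans ?_ (linear_apply_eq_sum ((LinearMap.proj z).comp
      (G.genCLM.toLinearMap.comp (G.heat r).toLinearMap)) (G.fluct η)).symm
    simp [genCLM_apply, fluctCoord_apply]
  rw [ContinuousMap.sum_apply, wtInner, Finset.mul_sum]
  refine Finset.sum_congr rfl fun z _ => ?_
  simp only [ContinuousMap.smul_apply, ContinuousMap.add_apply, ContinuousMap.mul_apply, h2,
    heatCoord_apply, smul_eq_mul]
  ring

/-- Expand the square of P_r h + P_r(P_xy h - h): the cross terms add up to the drift of the chain,
the squares to the noise. -/
theorem avgGenerator_heatSq (G : WeightedGraph V) (r : ℝ) (η : stdSimplex ℝ V) :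
    G.avgGenerator (G.heatSq r) η =
      2 * G.wtInner (G.heat r (G.fluct η)) (G.binGenerator (G.heat r (G.fluct η))) +
      G.edgeSum fun x y => G.normSq (G.heat r (G.resample x y (G.fluct η) - G.fluct η)) := by
  set h := G.fluct η with hh
  have h1 : ∀ x y, G.heatSq r (G.split x y η) - G.heatSq r η =
      2 * G.wtInner (G.heat r h) (G.heat r (G.resample x y h - h)) +
        G.normSq (G.heat r (G.resample x y h - h)) := by
    intro x y
    have h2 : G.heat r (G.resample x y h) = G.heat r h + G.heat r (G.resample x y h - h) := by
      rw [← map_add]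
      congr 1
      abel
    rw [heatSq_apply, heatSq_apply, fluct_split, ← hh, h2, normSq_add]
    ring
  rw [avgGenerator_apply]
  simp only [h1]
  rw [edgeSum_add, edgeSum_const_mul, ← heat_binGenerator]
  congr 2
  exact (G.map_edgeSum ((G.wtInnerLeft (G.heat r h)).comp (G.heat r).toLinearMap) _).symm

/-- The noise gives back half of the drift -2𝓔, which is why the plain gap estimate has rate gap and
not 2 gap. -/
theorem avgGenerator_heatSq_zero (G : WeightedGraph V) (η : stdSimplex ℝ V) :
    G.avgGenerator (G.heatSq 0) η = -G.dirichletForm (G.fluct η) := by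
  rw [avgGenerator_heatSq]
  simp only [heat_zero]
  rw [wtInner_binGenerator_self, ← dirichletForm_eq]
  ring

/-- The derivative of `s ↦ E_η ‖P_{t-s}(η_s / π - 1)‖₂²`. -/
theorem exists_hasDerivAt_avgExpect_heatSq (G : WeightedGraph V) (η : stdSimplex ℝ V) (t s : ℝ) :
    ∃ F : C(stdSimplex ℝ V, ℝ),
      HasDerivAt (fun s => G.avgExpect η s (G.heatSq (t - s))) (G.avgExpect η s F) s ∧
      ∀ ξ, F ξ = G.edgeSum fun x y =>
        G.normSq (G.heat (t - s) (G.resample x y (G.fluct ξ) - G.fluct ξ)) := by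
  obtain ⟨F, hF, hF'⟩ := G.exists_hasDerivAt_heatSq (t - s)
  have h1 : HasDerivAt (fun s => G.heatSq (t - s)) (-F) s := by
    exact (hF.scomp s ((hasDerivAt_id s).const_sub t)).congr_deriv (by simp)
  refine ⟨_, G.hasDerivAt_avgExpect_of_hasDerivAt η h1, fun ξ => ?_⟩
  -- The drift cancels against the derivative in t - s; only the noise survives.
  rw [ContinuousMap.add_apply, avgGenerator_heatSq, ContinuousMap.neg_apply, hF']
  ring

end WeightedGraph
end

/-! ### Second moment decay at rate 2 gap up to a small noise term -/

noncomputable section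
namespace WeightedGraph

variable {V : Type*} [Fintype V] [DecidableEq V]

theorem avgExpect_le_exp_mul (G : WeightedGraph V) (η : stdSimplex ℝ V)
    {f : C(stdSimplex ℝ V, ℝ)} {l : ℝ} (hf : ∀ ξ, G.avgGenerator f ξ ≤ -(l * f ξ))
    {t : ℝ} (ht : 0 ≤ t) : G.avgExpect η t f ≤ Real.exp (-(l * t)) * f η := by
  have hd : ∀ s, HasDerivAt (fun s => Real.exp (l * s) * G.avgExpect η s f)
      (Real.exp (l * s) * G.avgExpect η s (l • f + G.avgGenerator f)) s := by
    intro s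
    have h1 : HasDerivAt (fun s => Real.exp (l * s)) (Real.exp (l * s) * (l * 1)) s :=
      ((hasDerivAt_id s).const_mul l).exp
    refine (h1.mul (G.hasDerivAt_avgExpect η f s)).congr_deriv ?_
    rw [avgExpect_add, avgExpect_smul]
    ring
  have hanti : AntitoneOn (fun s => Real.exp (l * s) * G.avgExpect η s f) (Set.Icc 0 t) := by
    refine antitoneOn_of_deriv_nonpos (convex_Icc 0 t)
      (fun s _ => (hd s).continuousAt.continuousWithinAt)
      (fun s _ => (hd s).differentiableAt.differentiableWithinAt) fun s hs => ?_
    rw [interior_Icc] at hs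
    rw [(hd s).deriv]
    refine mul_nonpos_of_nonneg_of_nonpos (Real.exp_pos _).le ?_
    have h := G.avgExpect_nonneg η hs.1.le (f := -(l • f + G.avgGenerator f)) fun ξ => by
      have := hf ξ
      simp only [ContinuousMap.neg_apply, ContinuousMap.add_apply, ContinuousMap.smul_apply,
        smul_eq_mul]
      linarith
    rw [avgExpect_neg] at h
    linarith
  have h := hanti (Set.left_mem_Icc.mpr ht) (Set.right_mem_Icc.mpr ht) ht
  simp only [mul_zero, Real.exp_zero, one_mul, avgExpect_zero] at h
  rw [Real.exp_neg, ← div_eq_inv_mul, le_div_iff₀ (Real.exp_pos _), mul_comm]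
  exact h

theorem heatSq_nonneg (G : WeightedGraph V) (r : ℝ) (η : stdSimplex ℝ V) :
    0 ≤ G.heatSq r η := by
  rw [heatSq_apply]
  exact G.normSq_nonneg _

theorem avgExpect_heatSq_zero_le (G : WeightedGraph V) (η : stdSimplex ℝ V) {t : ℝ} (ht : 0 ≤ t) :
    G.avgExpect η t (G.heatSq 0) ≤ Real.exp (-(G.gap * t)) * G.heatSq 0 η := by
  refine G.avgExpect_le_exp_mul η (fun ξ => ?_) ht
  rw [avgGenerator_heatSq_zero, heatSq_zero_apply, neg_le_neg_iff]
  exact G.gap_mul_normSq_le (G.wtInner_one_fluct ξ)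

/-- The squared norm of the mean is at most the second moment. This transfers the bound K from the
process to the chain. -/
theorem normSq_heat_fluct_le (G : WeightedGraph V) (η : stdSimplex ℝ V) {t : ℝ} (ht : 0 ≤ t) :
    G.normSq (G.heat t (G.fluct η)) ≤ G.avgExpect η t (G.heatSq 0) := by
  choose F hF hF' using fun s => G.exists_hasDerivAt_avgExpect_heatSq η t s
  have hmono : MonotoneOn (fun s => G.avgExpect η s (G.heatSq (t - s))) (Set.Icc 0 t) := by
    refine monotoneOn_of_deriv_nonneg (convex_Icc 0 t)
      (fun s _ => (hF s).continuousAt.continuousWithinAt)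
      (fun s _ => (hF s).differentiableAt.differentiableWithinAt) fun s hs => ?_
    rw [interior_Icc] at hs
    rw [(hF s).deriv]
    refine G.avgExpect_nonneg η hs.1.le fun ξ => ?_
    rw [hF']
    exact G.edgeSum_nonneg fun x y => G.normSq_nonneg _
  have h := hmono (Set.left_mem_Icc.mpr ht) (Set.right_mem_Icc.mpr ht) ht
  simpa [avgExpect_zero, heatSq_apply] using h

theorem wtInner_one_dipole (G : WeightedGraph V) (x y : V) : G.wtInner 1 (G.dipole x y) = 0 := by
  rw [wtInner_dipole]
  simp

theorem wtInner_one_resample_sub (G : WeightedGraph V) (x y : V) (ψ : V → ℝ) :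
    G.wtInner 1 (G.resample x y ψ - ψ) = 0 := by
  rw [resample_sub_self, wtInner_smul_right, wtInner_one_dipole, mul_zero]

theorem dipole_eq (G : WeightedGraph V) (x y : V) :
    G.dipole x y = G.fluct ⟨Pi.single x 1, single_mem_stdSimplex ℝ x⟩ -
      G.fluct ⟨Pi.single y 1, single_mem_stdSimplex ℝ y⟩ := by
  funext z
  simp only [dipole, fluct, Pi.sub_apply, Pi.single_apply]
  by_cases h1 : z = x <;> by_cases h2 : z = y
  · subst h1; subst h2; simp
  · subst h1; simp [h2]
  · subst h2; simp [h1]; ring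
  · simp [h1, h2]

/-- At time b the image of a dipole, a difference of two fluctuations, has squared norm at most 4K;
the gap contracts it afterwards. As the dipole itself has squared norm 1/π(x) + 1/π(y) ≥ 2/m, the
relative gain is 2Km. -/
theorem normSq_heat_dipole_le (G : WeightedGraph V) {b K m : ℝ} (hb : 0 ≤ b)
    (hK : ∀ η, G.avgExpect η b (G.heatSq 0) ≤ K) (hm : ∀ x, G.wt x ≤ m) {r : ℝ} (hr : b ≤ r)
    (x y : V) :
    G.normSq (G.heat r (G.dipole x y)) ≤
      2 * K * m * Real.exp (-(2 * G.gap * (r - b))) * G.normSq (G.dipole x y) := by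
  by_cases hxy : x = y
  · subst hxy
    have h0 : G.dipole x x = 0 := by
      funext z
      simp [dipole]
    rw [h0, map_zero]
    simp [normSq]
  have h1 : G.normSq (G.heat b (G.dipole x y)) ≤ 4 * K := by
    rw [dipole_eq, map_sub]
    refine (G.normSq_sub_le _ _).trans ?_
    have h := fun η => (G.normSq_heat_fluct_le η hb).trans (hK η)
    linarith [h ⟨Pi.single x 1, single_mem_stdSimplex ℝ x⟩,
      h ⟨Pi.single y 1, single_mem_stdSimplex ℝ y⟩]
  have h2 : G.normSq (G.heat r (G.dipole x y)) ≤
      Real.exp (-(2 * G.gap * (r - b))) * (4 * K) := by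
    have h3 : r = (r - b) + b := by ring
    conv_lhs => rw [h3]
    rw [heat_add]
    refine (G.normSq_heat_le (by rw [wtInner_one_heat, wtInner_one_dipole])
      (sub_nonneg.mpr hr)).trans ?_
    exact mul_le_mul_of_nonneg_left h1 (Real.exp_pos _).le
  refine h2.trans ?_
  have hmx : ∀ x, 1 ≤ m * (G.wt x)⁻¹ := fun x => by
    rw [← div_eq_mul_inv, one_le_div (G.wt_pos x)]
    exact hm x
  have h4 : 2 ≤ m * G.normSq (G.dipole x y) := by
    rw [normSq_dipole G hxy]
    linarith [hmx x, hmx y]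
  have hK0 : 0 ≤ K := by linarith [G.normSq_nonneg (G.heat b (G.dipole x y))]
  have h5 : 0 ≤ 2 * K * Real.exp (-(2 * G.gap * (r - b))) := by positivity
  nlinarith

theorem exp_half_le : Real.exp (1 / 2) ≤ 5 / 3 := by
  have h1 : Real.exp (1 / 2) ^ 2 = Real.exp 1 := by
    rw [← Real.exp_nat_mul]
    norm_num
  have h2 := Real.exp_one_lt_d9
  by_contra! h
  nlinarith

theorem normSq_heat_resample_sub_le (G : WeightedGraph V) {b K m : ℝ} (hb : 0 ≤ b)
    (hgb : G.gap * b = 1 / 4) (hK : ∀ η, G.avgExpect η b (G.heatSq 0) ≤ K)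
    (hm : ∀ x, G.wt x ≤ m) {r : ℝ} (hr : b ≤ r) (x y : V) (ψ : V → ℝ) :
    G.normSq (G.heat r (G.resample x y ψ - ψ)) ≤
      4 * K * m * Real.exp (-(2 * G.gap * r)) * G.normSq (G.resample x y ψ - ψ) := by
  have h1 := G.normSq_heat_dipole_le hb hK hm hr x y
  have h2 : Real.exp (-(2 * G.gap * (r - b))) ≤ 2 * Real.exp (-(2 * G.gap * r)) := by
    have h3 : -(2 * G.gap * (r - b)) = 1 / 2 + -(2 * G.gap * r) := by linarith
    rw [h3, Real.exp_add]
    exact mul_le_mul_of_nonneg_right (exp_half_le.trans (by norm_num)) (Real.exp_pos _).le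
  have hK0 : 0 ≤ K := (G.avgExpect_nonneg ⟨Pi.single x 1, single_mem_stdSimplex ℝ x⟩ hb
    (G.heatSq_nonneg 0)).trans (hK _)
  have hm0 : 0 ≤ m := (G.wt_pos x).le.trans (hm x)
  have h4 := G.normSq_nonneg (G.dipole x y)
  rw [resample_sub_self, map_smul, normSq_smul, normSq_smul]
  set α := G.wt x * G.wt y / (G.wt x + G.wt y) * (ψ y - ψ x)
  calc α ^ 2 * G.normSq (G.heat r (G.dipole x y))
      ≤ α ^ 2 * (2 * K * m * (2 * Real.exp (-(2 * G.gap * r))) * G.normSq (G.dipole x y)) := by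
        refine mul_le_mul_of_nonneg_left (h1.trans ?_) (sq_nonneg α)
        gcongr
    _ = _ := by ring

/-- With Φ(s) = E‖P_{t-s} h_s‖², the increase of Φ from 0 to t is split at t - b. The recent noise
costs w(t-b) - w(t), whence the factor 2 on the left; the older noise carries the small factor κ =
4Km. -/
theorem two_mul_avgExpect_heatSq_le (G : WeightedGraph V) {b K m : ℝ} (hb : 0 ≤ b)
    (hgb : G.gap * b = 1 / 4) (hK : ∀ η, G.avgExpect η b (G.heatSq 0) ≤ K)
    (hm : ∀ x, G.wt x ≤ m) (η : stdSimplex ℝ V) {t : ℝ} (ht : b ≤ t) :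
    2 * G.avgExpect η t (G.heatSq 0) ≤ G.avgExpect η (t - b) (G.heatSq 0) +
      (Real.exp (-(2 * G.gap * t)) + 3 * (4 * K * m) * Real.exp (-(G.gap * t))) *
        G.heatSq 0 η := by
  set κ := 4 * K * m with hκ
  have hκ0 : 0 ≤ κ := by
    have hK0 : 0 ≤ K := (G.avgExpect_nonneg η hb (G.heatSq_nonneg 0)).trans (hK _)
    obtain ⟨x⟩ := G.connected.nonempty
    have hm0 : 0 ≤ m := (G.wt_pos x).le.trans (hm x)
    positivity
  set W := G.heatSq 0 η with hW
  have hW0 : 0 ≤ W := G.heatSq_nonneg 0 η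
  choose F hF hF' using fun s => G.exists_hasDerivAt_avgExpect_heatSq η t s
  have hw := fun s => G.hasDerivAt_avgExpect η (G.heatSq 0) s
  set Φ := fun s => G.avgExpect η s (G.heatSq (t - s)) with hΦ
  set w := fun s => G.avgExpect η s (G.heatSq 0) with hwdef
  -- If P_{t-s} shrinks squared norms of increments by q, then Φ' ≤ -q w'.
  have hFq : ∀ q s, 0 ≤ s → (∀ x y ψ, G.normSq (G.heat (t - s) (G.resample x y ψ - ψ)) ≤
      q * G.normSq (G.resample x y ψ - ψ)) →
      G.avgExpect η s (F s) + q * G.avgExpect η s (G.avgGenerator (G.heatSq 0)) ≤ 0 := by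
    intro q s hs hq
    rw [← avgExpect_smul, ← avgExpect_add, ← neg_nonneg, ← avgExpect_neg]
    refine G.avgExpect_nonneg η hs fun ξ => ?_
    simp only [ContinuousMap.neg_apply, ContinuousMap.add_apply, ContinuousMap.smul_apply,
      smul_eq_mul]
    rw [hF', avgGenerator_heatSq_zero, dirichletForm_eq, mul_neg, ← edgeSum_const_mul]
    have := G.edgeSum_mono fun x y => hq x y (G.fluct ξ)
    linarith
  have h1 : AntitoneOn (fun s => Φ s + w s) (Set.Icc (t - b) t) := by
    have hd := fun s => (hF s).add (hw s)
    refine antitoneOn_of_deriv_nonpos (convex_Icc _ t)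
      (fun s _ => (hd s).continuousAt.continuousWithinAt)
      (fun s _ => (hd s).differentiableAt.differentiableWithinAt) fun s hs => ?_
    rw [interior_Icc] at hs
    refine (hd s).deriv.trans_le ?_
    have := hFq 1 s (by linarith [hs.1]) fun x y ψ => by
      rw [one_mul]
      exact G.normSq_heat_le_self (G.wtInner_one_resample_sub x y ψ) (by linarith [hs.2])
    linarith
  -- Integration by parts of Φ' ≤ -κ e^{-2 gap (t-s)} w': the last term absorbs the derivative of
  -- the weight, using w(s) ≤ e^{-gap s} W. The boundary terms cost (1 + 2) κ e^{-gap t} W, the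
  -- source of the 3.
  have h2 : AntitoneOn (fun s => Φ s + κ * (Real.exp (-(2 * G.gap * (t - s))) * w s) -
      2 * κ * W * Real.exp (-(2 * G.gap * t) + G.gap * s)) (Set.Icc 0 (t - b)) := by
    have he1 : ∀ s, HasDerivAt (fun s => Real.exp (-(2 * G.gap * (t - s))))
        (Real.exp (-(2 * G.gap * (t - s))) * (-(2 * G.gap * -1))) s := fun s =>
      ((((hasDerivAt_id s).const_sub t).const_mul (2 * G.gap)).neg).exp
    have he2 : ∀ s, HasDerivAt (fun s => Real.exp (-(2 * G.gap * t) + G.gap * s))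
        (Real.exp (-(2 * G.gap * t) + G.gap * s) * (G.gap * 1)) s := fun s =>
      (((hasDerivAt_id s).const_mul G.gap).const_add _).exp
    have hd := fun s => ((hF s).add (((he1 s).mul (hw s)).const_mul κ)).sub
      ((he2 s).const_mul (2 * κ * W))
    refine antitoneOn_of_deriv_nonpos (convex_Icc _ _)
      (fun s _ => (hd s).continuousAt.continuousWithinAt)
      (fun s _ => (hd s).differentiableAt.differentiableWithinAt) fun s hs => ?_
    rw [interior_Icc] at hs
    refine (hd s).deriv.trans_le ?_
    have h3 := hFq (κ * Real.exp (-(2 * G.gap * (t - s)))) s hs.1.le fun x y ψ =>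
      G.normSq_heat_resample_sub_le hb hgb hK hm (by linarith [hs.2]) x y ψ
    have h4 := G.avgExpect_heatSq_zero_le η hs.1.le
    have h5 : Real.exp (-(2 * G.gap * (t - s))) * Real.exp (-(G.gap * s)) =
        Real.exp (-(2 * G.gap * t) + G.gap * s) := by
      rw [← Real.exp_add]
      congr 1
      ring
    have h6 : κ * Real.exp (-(2 * G.gap * (t - s))) * (2 * G.gap) *
        G.avgExpect η s (G.heatSq 0) ≤
        κ * Real.exp (-(2 * G.gap * (t - s))) * (2 * G.gap) *
          (Real.exp (-(G.gap * s)) * W) := by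
      refine mul_le_mul_of_nonneg_left h4 ?_
      have := G.gap_nonneg
      positivity
    have h7 : κ * Real.exp (-(2 * G.gap * (t - s))) * (2 * G.gap) *
          (Real.exp (-(G.gap * s)) * W) =
        2 * κ * W * (Real.exp (-(2 * G.gap * t) + G.gap * s) * (G.gap * 1)) := by
      rw [← h5]
      ring
    linarith
  have h3 := h1 (Set.left_mem_Icc.mpr (by linarith)) (Set.right_mem_Icc.mpr (by linarith))
    (by linarith)
  have h4 := h2 (Set.left_mem_Icc.mpr (by linarith)) (Set.right_mem_Icc.mpr (by linarith))
    (by linarith)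
  have hgt : 0 ≤ G.gap * t := mul_nonneg G.gap_nonneg (hb.trans ht)
  have h5 : Φ t = w t := by simp only [hΦ, hwdef, sub_self]
  have h6 : Φ 0 ≤ Real.exp (-(2 * G.gap * t)) * W := by
    simp only [hΦ, avgExpect_zero, hW, sub_zero, heatSq_zero_apply]
    rw [heatSq_apply]
    exact G.normSq_heat_le (G.wtInner_one_fluct η) (hb.trans ht)
  have h7 : w 0 = W := G.avgExpect_zero η _
  have h8 : Real.exp (-(2 * G.gap * t)) ≤ Real.exp (-(G.gap * t)) :=
    Real.exp_le_exp.mpr (by linarith)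
  have h9 : Real.exp (-(2 * G.gap * t) + G.gap * (t - b)) ≤ Real.exp (-(G.gap * t)) :=
    Real.exp_le_exp.mpr (by linarith)
  have h10 : 0 ≤ κ * (Real.exp (-(2 * G.gap * (t - (t - b)))) * w (t - b)) := by
    have : 0 ≤ w (t - b) := G.avgExpect_nonneg η (by linarith) (G.heatSq_nonneg 0)
    positivity
  have h11 : 0 ≤ 2 * κ * W * Real.exp (-(2 * G.gap * t) + G.gap * 0) := by positivity
  have h12 : κ * W * Real.exp (-(2 * G.gap * t)) ≤ κ * W * Real.exp (-(G.gap * t)) :=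
    mul_le_mul_of_nonneg_left h8 (by positivity)
  have h13 : κ * W * Real.exp (-(2 * G.gap * t) + G.gap * (t - b)) ≤
      κ * W * Real.exp (-(G.gap * t)) :=
    mul_le_mul_of_nonneg_left h9 (by positivity)
  simp only [h5, h7, sub_zero] at h3 h4
  change 2 * w t ≤ w (t - b) + _
  linarith

/-- Iterate the recursion in steps of b. Going back by b inflates the bound by at most e^{1/2} ≤
5/3, and 3 · 5/3 + 1 = 2 · 3, so the constant 3 reproduces itself. For t < b monotonicity suffices,
as e^{-2 gap t} ≥ 1/3. -/
theorem avgExpect_heatSq_le (G : WeightedGraph V) {b K m : ℝ} (hb : 0 ≤ b)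
    (hgb : G.gap * b = 1 / 4) (hK : ∀ η, G.avgExpect η b (G.heatSq 0) ≤ K)
    (hm : ∀ x, G.wt x ≤ m) (η : stdSimplex ℝ V) {t : ℝ} (ht : 0 ≤ t) :
    G.avgExpect η t (G.heatSq 0) ≤
      3 * (Real.exp (-(2 * G.gap * t)) + 3 * (4 * K * m) * Real.exp (-(G.gap * t))) *
        G.heatSq 0 η := by
  have hW0 : 0 ≤ G.heatSq 0 η := G.heatSq_nonneg 0 η
  have hκ0 : 0 ≤ 4 * K * m := by
    have hK0 : 0 ≤ K := (G.avgExpect_nonneg η hb (G.heatSq_nonneg 0)).trans (hK _)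
    obtain ⟨x⟩ := G.connected.nonempty
    have hm0 : 0 ≤ m := (G.wt_pos x).le.trans (hm x)
    positivity
  have hb0 : 0 < b := hb.lt_of_ne fun h => by
    rw [← h] at hgb
    norm_num at hgb
  obtain ⟨N, hN⟩ := exists_nat_gt (t / b)
  rw [div_lt_iff₀ hb0] at hN
  induction N generalizing t with
  | zero => simp at hN; linarith
  | succ N ih =>
    by_cases htb : t < b
    · have h1 := G.avgExpect_heatSq_zero_le η ht
      have h2 : Real.exp (-(G.gap * t)) ≤ 1 := by
        rw [Real.exp_le_one_iff]
        have := mul_nonneg G.gap_nonneg ht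
        linarith
      have h3 : 1 / 3 ≤ Real.exp (-(2 * G.gap * t)) := by
        have h4 := Real.add_one_le_exp (-(2 * G.gap * t))
        have h5 : G.gap * t ≤ G.gap * b := mul_le_mul_of_nonneg_left htb.le G.gap_nonneg
        linarith
      have h6 : 0 ≤ 3 * (4 * K * m) * Real.exp (-(G.gap * t)) := by positivity
      have h7 : 1 * G.heatSq 0 η ≤
          3 * (Real.exp (-(2 * G.gap * t)) + 3 * (4 * K * m) * Real.exp (-(G.gap * t))) *
            G.heatSq 0 η := mul_le_mul_of_nonneg_right (by linarith) hW0
      have h8 := mul_le_mul_of_nonneg_right h2 hW0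
      linarith
    · push Not at htb
      have h1 := G.two_mul_avgExpect_heatSq_le hb hgb hK hm η htb
      have h2 := ih (t := t - b) (by linarith) (by push_cast at hN; linarith)
      have e1 : Real.exp (-(2 * G.gap * (t - b))) ≤ 5 / 3 * Real.exp (-(2 * G.gap * t)) := by
        have h3 : -(2 * G.gap * (t - b)) = 1 / 2 + -(2 * G.gap * t) := by linarith
        rw [h3, Real.exp_add]
        exact mul_le_mul_of_nonneg_right exp_half_le (Real.exp_pos _).le
      have e2 : Real.exp (-(G.gap * (t - b))) ≤ 5 / 3 * Real.exp (-(G.gap * t)) := by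
        have h3 : -(G.gap * (t - b)) = 1 / 4 + -(G.gap * t) := by linarith
        rw [h3, Real.exp_add]
        refine mul_le_mul_of_nonneg_right (le_trans ?_ exp_half_le) (Real.exp_pos _).le
        exact Real.exp_le_exp.mpr (by norm_num)
      have e3 : 3 * (4 * K * m) * Real.exp (-(G.gap * (t - b))) ≤
          3 * (4 * K * m) * (5 / 3 * Real.exp (-(G.gap * t))) :=
        mul_le_mul_of_nonneg_left e2 (by positivity)
      have e4 := mul_le_mul_of_nonneg_right (add_le_add e1 e3) hW0
      linarith

end WeightedGraph
end

/-! ### Smoothing from the Nash inequality -/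

noncomputable section
namespace WeightedGraph

variable {V : Type*} [Fintype V]

theorem lpNorm_two (G : WeightedGraph V) (ψ : V → ℝ) : G.lpNorm 2 ψ = √(G.normSq ψ) := by
  rw [lpNorm, Real.sqrt_eq_rpow, normSq]
  simp

theorem dirichletForm_fluct (G : WeightedGraph V) (η : stdSimplex ℝ V) :
    G.dirichletForm (fun x => η.1 x / G.wt x) = G.dirichletForm (G.fluct η) := by
  simp [dirichletForm, fluct]

theorem normSq_density (G : WeightedGraph V) (η : stdSimplex ℝ V) :
    G.normSq (fun x => η.1 x / G.wt x) = G.normSq (G.fluct η) + 1 := by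
  have h : (fun x => η.1 x / G.wt x) = G.fluct η + 1 := by
    funext x
    simp [fluct]
  rw [h, normSq_add, wtInner_comm, wtInner_one_fluct]
  simp [normSq, G.sum_wt]

theorem lpNorm_one_density (G : WeightedGraph V) (η : stdSimplex ℝ V) :
    G.lpNorm 1 (fun x => η.1 x / G.wt x) = 1 := by
  simp only [lpNorm, div_one, Real.rpow_one]
  rw [← η.2.2]
  refine Finset.sum_congr rfl fun x _ => ?_
  have := G.wt_pos x
  rw [abs_of_nonneg (div_nonneg (η.2.1 x) this.le)]
  field_simp

/-- The Nash inequality for probability densities. -/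
theorem Nash.le_dirichletForm {G : WeightedGraph V} {d N T : ℝ} (h : G.Nash d N T)
    (η : stdSimplex ℝ V) :
    (G.normSq (G.fluct η) + 1) ^ (1 + 2 / d) ≤
      N * (G.dirichletForm (G.fluct η) + T⁻¹ * (G.normSq (G.fluct η) + 1)) := by
  have h1 := h fun x => η.1 x / G.wt x
  have h0 : 0 ≤ G.normSq (G.fluct η) + 1 := add_nonneg (G.normSq_nonneg _) zero_le_one
  rw [lpNorm_one_density, Real.one_rpow, mul_one, lpNorm_two, normSq_density,
    dirichletForm_fluct, Real.sq_sqrt h0, Real.rpow_mul (Real.sqrt_nonneg _), Real.rpow_two,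
    Real.sq_sqrt h0] at h1
  exact h1

/-- The tangent line of the convex function `u ↦ u ^ (1 + a)` at `l`. -/
theorem tangent_le_rpow {a l u : ℝ} (ha : 0 ≤ a) (hl : 0 < l) (hu : 0 ≤ u) :
    l ^ (1 + a) + (1 + a) * l ^ a * (u - l) ≤ u ^ (1 + a) := by
  have h1 := one_add_mul_self_le_rpow_one_add (s := u / l - 1) (p := 1 + a)
    (by linarith [div_nonneg hu hl.le]) (by linarith)
  rw [add_sub_cancel, Real.div_rpow hu hl.le, le_div_iff₀ (Real.rpow_pos_of_pos hl _)] at h1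
  refine le_trans (le_of_eq ?_) h1
  rw [Real.rpow_add hl, Real.rpow_one]
  field_simp

variable [DecidableEq V]

/-- Instantaneous smoothing: a Nash inequality bounds the second moment uniformly over initial
conditions. -/
theorem avgExpect_heatSq_le_of_nash (G : WeightedGraph V) {a A B b : ℝ} (ha : 0 < a) (hA : 0 < A)
    (hB : 0 < B) (hb : 0 < b)
    (hN : ∀ η, (G.normSq (G.fluct η) + 1) ^ (1 + a) - A * (G.normSq (G.fluct η) + 1) ≤
      B * G.dirichletForm (G.fluct η)) (η : stdSimplex ℝ V) :
    G.avgExpect η b (G.heatSq 0) ≤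
      (2 * A) ^ (1 / a) + (2 * B / (a * b)) ^ (1 / a) := by
  set K := (2 * A) ^ (1 / a) + (2 * B / (a * b)) ^ (1 / a) with hK
  have hK1 : 0 < (2 * A) ^ (1 / a) := by positivity
  have hK2 : 0 < (2 * B / (a * b)) ^ (1 / a) := by positivity
  -- U = w + 1 is nonincreasing, so if it exceeds K at b it does so on all of [0, b]. There the
  -- first term of K lets U^{1+a} absorb AU; the second contradicts the decay of U by time b.
  by_contra! hcon
  set U := fun s => G.avgExpect η s (G.heatSq 0) + 1 with hU
  set U' := fun s => G.avgExpect η s (G.avgGenerator (G.heatSq 0)) with hU'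
  have hd : ∀ s, HasDerivAt U (U' s) s := fun s =>
    (G.hasDerivAt_avgExpect η (G.heatSq 0) s).add_const 1
  have hanti : AntitoneOn U (Set.Icc 0 b) := by
    refine antitoneOn_of_deriv_nonpos (convex_Icc _ _)
      (fun s _ => (hd s).continuousAt.continuousWithinAt)
      (fun s _ => (hd s).differentiableAt.differentiableWithinAt) fun s hs => ?_
    rw [interior_Icc] at hs
    refine (hd s).deriv.trans_le ?_
    have h := G.avgExpect_nonneg η hs.1.le (f := -G.avgGenerator (G.heatSq 0)) fun ξ => by
      rw [ContinuousMap.neg_apply, avgGenerator_heatSq_zero, neg_neg]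
      exact G.dirichletForm_nonneg _
    rw [avgExpect_neg] at h
    exact neg_nonneg.mp h
  have hbig : ∀ s ∈ Set.Icc 0 b, K < U s := fun s hs => by
    have h1 := hanti hs (Set.right_mem_Icc.mpr hb.le) hs.2
    have h2 : U b = G.avgExpect η b (G.heatSq 0) + 1 := rfl
    linarith
  have hUpos : ∀ s ∈ Set.Icc 0 b, 0 < U s := fun s hs => by
    have := hbig s hs
    linarith
  have hpow : ∀ c, 0 < c → ∀ s ∈ Set.Icc 0 b, c ^ (1 / a) < U s → c < U s ^ a := by
    intro c hc s hs h
    have h1 := Real.rpow_lt_rpow (by positivity) h ha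
    rwa [← Real.rpow_mul hc.le, one_div_mul_cancel ha.ne', Real.rpow_one] at h1
  have hder : ∀ s ∈ Set.Icc 0 b, U' s ≤ -(U s ^ (1 + a) / (2 * B)) := by
    intro s hs
    have hl := hUpos s hs
    set l := U s with hl'
    -- Jensen for u ↦ u^{1+a}, by taking expectations of the tangent line at l = U(s).
    have h1 : G.avgExpect η s (((1 + a) * l ^ a - A) • (G.heatSq 0 + 1) +
        (-(a * l ^ (1 + a))) • 1) ≤ G.avgExpect η s (-(B • G.avgGenerator (G.heatSq 0))) := by
      refine G.avgExpect_mono η hs.1 fun ξ => ?_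
      have h2 := hN ξ
      have h3 := tangent_le_rpow (a := a) (l := l) (u := G.normSq (G.fluct ξ) + 1) ha.le hl
        (add_nonneg (G.normSq_nonneg _) zero_le_one)
      have h4 : l ^ (1 + a) = l * l ^ a := by rw [Real.rpow_add hl, Real.rpow_one]
      simp only [ContinuousMap.add_apply, ContinuousMap.smul_apply, ContinuousMap.neg_apply,
        ContinuousMap.one_apply, smul_eq_mul, avgGenerator_heatSq_zero, heatSq_zero_apply]
      rw [h4] at h3 ⊢
      linarith
    rw [avgExpect_add, avgExpect_smul, avgExpect_smul, avgExpect_add, avgExpect_one,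
      avgExpect_neg, avgExpect_smul] at h1
    change ((1 + a) * l ^ a - A) * l + -(a * l ^ (1 + a)) * 1 ≤ -(B * U' s) at h1
    have h5 : 2 * A < l ^ a := hpow _ (by positivity) s hs (by linarith [hbig s hs])
    have h6 : 2 * A * l < l ^ a * l := mul_lt_mul_of_pos_right h5 hl
    have h4 : l ^ (1 + a) = l * l ^ a := by rw [Real.rpow_add hl, Real.rpow_one]
    rw [h4] at h1 ⊢
    rw [le_neg, div_le_iff₀ (by positivity)]
    linarith
  -- U' ≤ -U^{1+a}/(2B) means that U^{-a} grows at least linearly, whatever U(0) is.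
  have hmono : MonotoneOn (fun s => U s ^ (-a) - a / (2 * B) * s) (Set.Icc 0 b) := by
    have hd2 : ∀ s ∈ Set.Icc 0 b, HasDerivAt (fun s => U s ^ (-a) - a / (2 * B) * s)
        (U' s * (-a) * U s ^ (-a - 1) - a / (2 * B) * 1) s := fun s hs =>
      ((hd s).rpow_const (Or.inl (hUpos s hs).ne')).sub
        ((hasDerivAt_id s).const_mul (a / (2 * B)))
    refine monotoneOn_of_deriv_nonneg (convex_Icc _ _)
      (fun s hs => (hd2 s hs).continuousAt.continuousWithinAt)
      (fun s hs => (hd2 s (interior_subset hs)).differentiableAt.differentiableWithinAt)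
      fun s hs => ?_
    have hs' := interior_subset hs
    rw [(hd2 s hs').deriv]
    have h1 := hder s hs'
    have hl := hUpos s hs'
    have h2 : U s ^ (1 + a) * U s ^ (-a - 1) = 1 := by
      rw [← Real.rpow_add hl, show 1 + a + (-a - 1) = 0 by ring, Real.rpow_zero]
    have h3 : 0 < U s ^ (-a - 1) := Real.rpow_pos_of_pos hl _
    have h4 : U s ^ (1 + a) / (2 * B) * (a * U s ^ (-a - 1)) ≤ -U' s * (a * U s ^ (-a - 1)) :=
      mul_le_mul_of_nonneg_right (by linarith) (by positivity)
    have h5 : U s ^ (1 + a) / (2 * B) * (a * U s ^ (-a - 1)) = a / (2 * B) := by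
      rw [div_mul_eq_mul_div, mul_left_comm, h2, mul_one]
    linarith
  have h1 := hmono (Set.left_mem_Icc.mpr hb.le) (Set.right_mem_Icc.mpr hb.le) hb.le
  have hbm : b ∈ Set.Icc 0 b := Set.right_mem_Icc.mpr hb.le
  have hl := hUpos b hbm
  have h2 := hpow (2 * B / (a * b)) (by positivity) b hbm (by linarith [hbig b hbm])
  have h3 : 0 < U 0 ^ (-a) := Real.rpow_pos_of_pos (hUpos 0 (Set.left_mem_Icc.mpr hb.le)) _
  simp only [mul_zero, sub_zero] at h1
  have h4 : a / (2 * B) * b ≤ (U b ^ a)⁻¹ := by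
    rw [← Real.rpow_neg hl.le]
    linarith
  have h5 : a / (2 * B) * b = (2 * B / (a * b))⁻¹ := by
    field_simp
  rw [h5] at h4
  exact absurd h2 (not_lt.mpr ((inv_le_inv₀ (by positivity) (Real.rpow_pos_of_pos hl a)).mp h4))

end WeightedGraph
end

/-! ### Bounds on the worst-case L^p distance -/

noncomputable section
namespace WeightedGraph

variable {V : Type*} [Fintype V]

theorem lpNorm_le_sqrt_normSq (G : WeightedGraph V) {p : ℝ} (hp : 1 ≤ p) (hp2 : p ≤ 2)
    (ψ : V → ℝ) : G.lpNorm p ψ ≤ √(G.normSq ψ) := by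
  have hp0 : 0 < p := by linarith
  have hz : ∀ x, 0 ≤ |ψ x| ^ p := fun x => Real.rpow_nonneg (abs_nonneg _) _
  have h := Real.rpow_arith_mean_le_arith_mean_rpow Finset.univ G.wt (fun x => |ψ x| ^ p)
    (fun x _ => (G.wt_pos x).le) G.sum_wt (fun x _ => hz x) (p := 2 / p)
    ((one_le_div hp0).mpr hp2)
  have h1 : ∑ x, G.wt x * (|ψ x| ^ p) ^ (2 / p) = G.normSq ψ := by
    refine Finset.sum_congr rfl fun x _ => ?_
    rw [← Real.rpow_mul (abs_nonneg _), mul_div_cancel₀ _ hp0.ne', Real.rpow_two, sq_abs]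
  rw [h1] at h
  have hs : 0 ≤ ∑ x, G.wt x * |ψ x| ^ p :=
    Finset.sum_nonneg fun x _ => mul_nonneg (G.wt_pos x).le (hz x)
  refine Real.le_sqrt_of_sq_le ?_
  rw [lpNorm, ← Real.rpow_two, ← Real.rpow_mul hs]
  convert h using 2
  ring

theorem sum_wt_mul_abs_le_lpNorm (G : WeightedGraph V) {p : ℝ} (hp : 1 ≤ p) (ψ : V → ℝ) :
    ∑ x, G.wt x * |ψ x| ≤ G.lpNorm p ψ := by
  have hp0 : 0 < p := by linarith
  have h := Real.rpow_arith_mean_le_arith_mean_rpow Finset.univ G.wt (fun x => |ψ x|)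
    (fun x _ => (G.wt_pos x).le) G.sum_wt (fun x _ => abs_nonneg _) hp
  have hs : 0 ≤ ∑ x, G.wt x * |ψ x| :=
    Finset.sum_nonneg fun x _ => mul_nonneg (G.wt_pos x).le (abs_nonneg _)
  have h1 := Real.rpow_le_rpow (Real.rpow_nonneg hs p) h (one_div_nonneg.mpr hp0.le)
  rwa [← Real.rpow_mul hs, mul_one_div_cancel hp0.ne', Real.rpow_one] at h1

theorem lpDist_apply (G : WeightedGraph V) (p : ℝ) (hp : 0 ≤ p) (η : stdSimplex ℝ V) :
    G.lpDist p hp η = G.lpNorm p (G.fluct η) := rfl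

theorem abs_wtInner_le (G : WeightedGraph V) (φ ψ : V → ℝ) :
    |G.wtInner φ ψ| ≤ (G.normSq φ + G.normSq ψ) / 2 := by
  rw [abs_le]
  have h1 := G.normSq_nonneg (φ + ψ)
  have h2 := G.normSq_nonneg (φ + (-1 : ℝ) • ψ)
  rw [normSq_add] at h1 h2
  rw [wtInner_smul_right, normSq_smul] at h2
  constructor <;> linarith

variable [DecidableEq V]

theorem avgWorstDist_le (G : WeightedGraph V) {p : ℝ} (hp : 1 ≤ p) (hp2 : p ≤ 2) {t ε : ℝ}
    (ht : 0 ≤ t) (hε : 0 < ε) (h : ∀ η, G.avgExpect η t (G.heatSq 0) ≤ ε ^ 2) :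
    G.avgWorstDist p (zero_le_one.trans hp) t ≤ ε := by
  obtain ⟨x⟩ := G.connected.nonempty
  have : Nonempty (stdSimplex ℝ V) := ⟨⟨Pi.single x 1, single_mem_stdSimplex ℝ x⟩⟩
  refine ciSup_le fun η => ?_
  -- Replaces Cauchy–Schwarz by the pointwise bound r ≤ r²/(2ε) + ε/2.
  have h1 : G.avgExpect η t (G.lpDist p (zero_le_one.trans hp)) ≤
      G.avgExpect η t ((2 * ε)⁻¹ • G.heatSq 0 + (ε / 2) • 1) := by
    refine G.avgExpect_mono η ht fun ξ => ?_
    rw [lpDist_apply]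
    refine (G.lpNorm_le_sqrt_normSq hp hp2 _).trans ?_
    simp only [ContinuousMap.add_apply, ContinuousMap.smul_apply, ContinuousMap.one_apply,
      smul_eq_mul, heatSq_zero_apply, mul_one]
    set r := √(G.normSq (G.fluct ξ)) with hr
    have h2 : r ^ 2 = G.normSq (G.fluct ξ) := Real.sq_sqrt (G.normSq_nonneg _)
    rw [← h2, inv_mul_eq_div, div_add_div _ _ (by positivity) (by positivity),
      le_div_iff₀ (by positivity)]
    nlinarith [sq_nonneg (r - ε)]
  refine h1.trans ?_
  rw [avgExpect_add, avgExpect_smul, avgExpect_smul, avgExpect_one]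
  have h2 : (2 * ε)⁻¹ * G.avgExpect η t (G.heatSq 0) ≤ (2 * ε)⁻¹ * ε ^ 2 :=
    mul_le_mul_of_nonneg_left (h η) (by positivity)
  have h3 : (2 * ε)⁻¹ * ε ^ 2 = ε / 2 := by field_simp
  linarith

theorem le_avgWorstDist (G : WeightedGraph V) (p : ℝ) (hp : 0 ≤ p) (t : ℝ) (η : stdSimplex ℝ V) :
    G.avgExpect η t (G.lpDist p hp) ≤ G.avgWorstDist p hp t := by
  refine le_ciSup (f := fun η => G.avgExpect η t (G.lpDist p hp))
    ⟨‖G.avgSemigroup t (G.lpDist p hp)‖, ?_⟩ η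
  rintro _ ⟨ξ, rfl⟩
  exact (le_abs_self _).trans
    (ContinuousMap.norm_coe_le_norm (G.avgSemigroup t (G.lpDist p hp)) ξ)

/-- The linear observable `η ↦ ∑ x, η(x) ψ(x)`. -/
def linearObs (ψ : V → ℝ) : C(stdSimplex ℝ V, ℝ) where
  toFun η := ∑ x, η.1 x * ψ x
  continuous_toFun := continuous_finsetSum _ fun x _ =>
    ((continuous_apply x).comp continuous_subtype_val).mul continuous_const

/-- The mean of h evolves by the single-particle generator, which is self-adjoint and can be moved
onto ψ. -/
theorem avgExpect_linearObs (G : WeightedGraph V) {ψ : V → ℝ} {μ : ℝ}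
    (h0 : G.wtInner 1 ψ = 0) (hψ : G.binGenerator ψ = μ • ψ) (η : stdSimplex ℝ V) (t : ℝ) :
    G.avgExpect η t (linearObs ψ) = Real.exp (t * μ) * linearObs ψ η := by
  refine G.avgExpect_eigenvector η t ?_
  ext ξ
  have h1 : ∀ ξ, linearObs ψ ξ = G.wtInner (G.fluct ξ) ψ := fun ξ =>
    (G.wtInner_fluct ξ ψ h0).symm
  have h2 : ∀ x y, linearObs ψ (G.split x y ξ) - linearObs ψ ξ =
      G.wtInner ψ (G.resample x y (G.fluct ξ) - G.fluct ξ) := fun x y => by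
    rw [h1, h1, fluct_split, wtInner_sub_right, wtInner_comm, wtInner_comm G _ ψ]
  rw [avgGenerator_apply]
  simp only [h2]
  refine (G.map_edgeSum (G.wtInnerLeft ψ)
    fun x y => G.resample x y (G.fluct ξ) - G.fluct ξ).symm.trans ?_
  change G.wtInner ψ (G.binGenerator (G.fluct ξ)) = μ * linearObs ψ ξ
  rw [wtInner_binGenerator_comm, hψ, wtInner_smul_right, h1]

/-- The eigenfunction of the gap bounds the worst-case distance from below. -/
theorem exp_le_mul_avgWorstDist (G : WeightedGraph V) [Nontrivial V] {b K : ℝ} (hb : 0 ≤ b)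
    (hgb : G.gap * b = 1 / 4) (hK : ∀ η, G.avgExpect η b (G.heatSq 0) ≤ K)
    {p : ℝ} (hp : 1 ≤ p) {t : ℝ} (ht : 0 ≤ t) :
    Real.exp (-(G.gap * t)) ≤
      (K + 1) ^ 2 * G.avgWorstDist p (zero_le_one.trans hp) t := by
  obtain ⟨ψ, h1, h0, hψ⟩ := G.exists_eigenfunction
  obtain ⟨z, -, hz⟩ := Finset.exists_max_image Finset.univ (fun x => |ψ x|)
    Finset.univ_nonempty
  have hz : ∀ x, |ψ x| ≤ |ψ z| := fun x => hz x (Finset.mem_univ x)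
  set M := |ψ z| with hM
  have hM0 : 0 < M := by
    refine (abs_nonneg _).lt_of_ne fun h => ?_
    have h2 : ψ = 0 := by
      funext x
      have := hz x
      rw [hM, ← h] at this
      exact abs_nonpos_iff.mp this
    rw [h2] at h1
    simp [normSq] at h1
  -- Start at a maximiser z of |ψ|: the mean of ⟨h_b, ψ⟩ is e^{-1/4} ψ(z), yet is at most (K + 1)/2
  -- in absolute value because ‖ψ‖₂ = 1.
  have hMK : M ≤ K + 1 := by
    set η : stdSimplex ℝ V := ⟨Pi.single z 1, single_mem_stdSimplex ℝ z⟩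
    have h2 := G.avgExpect_linearObs h0 hψ η b
    have h3 : linearObs ψ η = ψ z := by
      simp [linearObs, η, Pi.single_apply]
    have h4 : |G.avgExpect η b (linearObs ψ)| ≤ (K + 1) / 2 := by
      have h5 : ∀ ξ, |linearObs ψ ξ| ≤
          ((1 / 2 : ℝ) • (G.heatSq 0 + 1) : C(stdSimplex ℝ V, ℝ)) ξ := by
        intro ξ
        have h6 := G.abs_wtInner_le (G.fluct ξ) ψ
        rw [G.wtInner_fluct ξ ψ h0, h1] at h6
        simp only [ContinuousMap.add_apply, ContinuousMap.smul_apply, ContinuousMap.one_apply,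
          smul_eq_mul, heatSq_zero_apply]
        exact h6.trans (by linarith)
      have h7 := G.avgExpect_mono η hb fun ξ => (le_abs_self _).trans (h5 ξ)
      have h8 := G.avgExpect_mono η hb (f := -linearObs ψ) fun ξ =>
        (neg_le_abs _).trans (h5 ξ)
      rw [avgExpect_smul, avgExpect_add, avgExpect_one] at h7 h8
      rw [avgExpect_neg] at h8
      rw [abs_le]
      constructor <;> linarith [hK η]
    rw [h2, h3, abs_mul, abs_of_pos (Real.exp_pos _)] at h4
    have h5 : 1 / 2 ≤ Real.exp (b * -G.gap) := by
      have := Real.add_one_le_exp (b * -G.gap)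
      linarith
    have h6 := mul_le_mul_of_nonneg_right h5 hM0.le
    linarith
  -- Perturbing π along ψ as far as positivity allows gives h_0 = ψ/M, aligned with the slowest
  -- mode.
  have hη0 : (fun x => G.wt x * (1 + ψ x / M)) ∈ stdSimplex ℝ V := by
    refine ⟨fun x => mul_nonneg (G.wt_pos x).le ?_, ?_⟩
    · have h2 := (abs_le.mp (hz x)).1
      have h3 : -1 ≤ ψ x / M := by
        rw [le_div_iff₀ hM0]
        linarith
      linarith
    · simp only [mul_add, mul_one, Finset.sum_add_distrib, G.sum_wt, mul_div_assoc']
      rw [← Finset.sum_div, ← wtInner_one, h0]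
      simp
  set η : stdSimplex ℝ V := ⟨_, hη0⟩ with hη
  have h2 : linearObs ψ η = 1 / M := by
    rw [show linearObs ψ η = ∑ x, η.1 x * ψ x from rfl, ← G.wtInner_fluct η ψ h0]
    have h3 : G.fluct η = M⁻¹ • ψ := by
      funext x
      have := (G.wt_pos x).ne'
      simp only [fluct, hη, Pi.smul_apply, smul_eq_mul]
      field_simp
      ring
    rw [h3, wtInner_comm, wtInner_smul_right, wtInner_self, h1, mul_one, one_div]
  have h3 : G.avgExpect η t (linearObs ψ) ≤
      G.avgExpect η t (M • G.lpDist p (zero_le_one.trans hp)) := by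
    refine G.avgExpect_mono η ht fun ξ => ?_
    rw [ContinuousMap.smul_apply, lpDist_apply, smul_eq_mul]
    refine le_trans ?_
      (mul_le_mul_of_nonneg_left (G.sum_wt_mul_abs_le_lpNorm hp (G.fluct ξ)) hM0.le)
    rw [show linearObs ψ ξ = ∑ x, ξ.1 x * ψ x from rfl, ← G.wtInner_fluct ξ ψ h0, wtInner,
      Finset.mul_sum]
    refine Finset.sum_le_sum fun x _ => ?_
    rw [mul_left_comm M]
    refine mul_le_mul_of_nonneg_left ?_ (G.wt_pos x).le
    refine (le_abs_self _).trans ?_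
    rw [abs_mul, mul_comm]
    exact mul_le_mul_of_nonneg_right (hz x) (abs_nonneg _)
  rw [avgExpect_smul, G.avgExpect_linearObs h0 hψ, h2, mul_one_div, div_le_iff₀ hM0] at h3
  have h4 := G.le_avgWorstDist p (zero_le_one.trans hp) t η
  have h5 : 0 ≤ G.avgExpect η t (G.lpDist p (zero_le_one.trans hp)) := by
    refine G.avgExpect_nonneg η ht fun ξ => ?_
    rw [lpDist_apply]
    exact (Finset.sum_nonneg fun x _ => mul_nonneg (G.wt_pos x).le (abs_nonneg _)).trans
      (G.sum_wt_mul_abs_le_lpNorm hp _)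
  calc Real.exp (-(G.gap * t)) = Real.exp (t * -G.gap) := by ring_nf
    _ ≤ M ^ 2 * G.avgExpect η t (G.lpDist p (zero_le_one.trans hp)) := by linarith
    _ ≤ (K + 1) ^ 2 * G.avgWorstDist p (zero_le_one.trans hp) t := by
      gcongr

end WeightedGraph
end

/-! ### Constants at the relaxation and cutoff time scales -/

noncomputable section
namespace WeightedGraph

variable {V : Type*} [Fintype V]

theorem wt_le_of_elliptic (G : WeightedGraph V) {c : ℝ} (h : ∀ x y, G.wt x ≤ c * G.wt y) (x : V) :
    G.wt x ≤ c / Fintype.card V := by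
  have hc : (0 : ℝ) < Fintype.card V := by
    exact_mod_cast Fintype.card_pos_iff.mpr ⟨x⟩
  rw [le_div_iff₀ hc]
  have h1 : ∑ _y : V, G.wt x ≤ ∑ y, c * G.wt y := Finset.sum_le_sum fun y _ => h x y
  rw [← Finset.mul_sum, G.sum_wt, Finset.sum_const, Finset.card_univ, nsmul_eq_mul] at h1
  linarith

theorem exp_neg_half_log {k : ℝ} (hk : 0 < k) : Real.exp (-(Real.log k / 2)) = (√k)⁻¹ := by
  rw [Real.exp_neg, Real.sqrt_eq_rpow, Real.rpow_def_of_pos hk]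
  congr 2
  ring

variable [DecidableEq V]

theorem tRel_pos (G : WeightedGraph V) [Nontrivial V] : 0 < G.tRel := inv_pos.mpr G.gap_pos

theorem gap_mul_tRel (G : WeightedGraph V) [Nontrivial V] : G.gap * G.tRel = 1 :=
  mul_inv_cancel₀ G.gap_pos.ne'

theorem avgExpect_tRel_le_of_nash (G : WeightedGraph V) [Nontrivial V] {d N T D c₁ c₂ : ℝ}
    (hd : 0 < d) (hN : 0 < N) (h : G.Nash d N T) (hD : d ≤ D)
    (h1 : N ≤ c₁ * G.tRel) (hc₂ : 0 < c₂) (h2 : N * T⁻¹ ≤ c₂) (η : stdSimplex ℝ V) :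
    G.avgExpect η (G.tRel / 4) (G.heatSq 0) ≤
      (2 * c₂) ^ (1 / (2 / D)) + (8 * c₁ / (2 / D)) ^ (1 / (2 / D)) := by
  have hτ := G.tRel_pos
  have hD0 : 0 < D := hd.trans_le hD
  have hB : 0 < c₁ * G.tRel := hN.trans_le h1
  refine (G.avgExpect_heatSq_le_of_nash (a := 2 / D) (A := c₂) (B := c₁ * G.tRel)
    (b := G.tRel / 4) (by positivity) hc₂ hB (by positivity) (fun ξ => ?_) η).trans_eq ?_
  · have h3 := h.le_dirichletForm ξ
    have h0 := G.normSq_nonneg (G.fluct ξ)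
    have hE := G.dirichletForm_nonneg (G.fluct ξ)
    set u := G.normSq (G.fluct ξ) + 1 with hu
    -- Since u ≥ 1, the varying exponent can be lowered to a fixed one, making the bound uniform in
    -- n.
    have h4 : u ^ (1 + 2 / D) ≤ u ^ (1 + 2 / d) := by
      refine Real.rpow_le_rpow_of_exponent_le (by linarith) ?_
      gcongr
    have h5 := mul_le_mul_of_nonneg_right h1 hE
    have h6 : N * T⁻¹ * u ≤ c₂ * u := mul_le_mul_of_nonneg_right h2 (by linarith)
    linarith
  · congr 2
    field_simp
    ring

/-- The second moment is of order `1 / k` slightly after time `(t_rel / 2) log k`. -/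
theorem mul_avgExpect_cutoffTime_le (G : WeightedGraph V) [Nontrivial V] {K m q : ℝ}
    (hK : ∀ η, G.avgExpect η (G.tRel / 4) (G.heatSq 0) ≤ K) (hm : ∀ x, G.wt x ≤ m)
    {k : ℕ} (hk : 1 ≤ k) (hq : √k * m ≤ q) {C : ℝ} (hC : 1 ≤ C) (η : stdSimplex ℝ V) :
    k * G.avgExpect η (G.cutoffTime k C) (G.heatSq 0) ≤
      6 * K * (1 + 12 * K * q) * Real.exp (-C) := by
  have hτ := G.tRel_pos
  have hgτ := G.gap_mul_tRel
  have hk0 : (0 : ℝ) < k := by exact_mod_cast hk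
  have hlog : 0 ≤ Real.log k := Real.log_nonneg (by exact_mod_cast hk)
  have hb : 0 ≤ G.tRel / 4 := by positivity
  -- The first t_rel/4 is spent on smoothing, so the decay over s starts from a second moment at
  -- most K.
  set s := G.tRel / 2 * Real.log k + (C - 1 / 4) * G.tRel with hs
  have hs0 : 0 ≤ s := by
    have : 0 ≤ C - 1 / 4 := by linarith
    positivity
  have hgs : G.gap * s = Real.log k / 2 + C - 1 / 4 := by
    rw [hs]
    linear_combination (Real.log k / 2 + C - 1 / 4) * hgτ
  have ht : G.cutoffTime k C = G.tRel / 4 + s := by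
    rw [cutoffTime, hs]
    ring
  have hK0 : 0 ≤ K := (G.avgExpect_nonneg η hb (G.heatSq_nonneg 0)).trans (hK η)
  set c := 3 * (Real.exp (-(2 * G.gap * s)) + 3 * (4 * K * m) * Real.exp (-(G.gap * s))) with hc
  have h1 : G.avgExpect η (G.cutoffTime k C) (G.heatSq 0) ≤
      G.avgExpect η (G.tRel / 4) (c • G.heatSq 0) := by
    rw [ht, avgExpect_add_time]
    refine G.avgExpect_mono η hb fun ξ => ?_
    exact G.avgExpect_heatSq_le hb (by linarith) hK hm ξ hs0
  obtain ⟨x⟩ := G.connected.nonempty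
  have hm0 : 0 ≤ m := (G.wt_pos x).le.trans (hm x)
  have hc0 : 0 ≤ c := by positivity
  rw [avgExpect_smul] at h1
  have h2 : c * G.avgExpect η (G.tRel / 4) (G.heatSq 0) ≤ c * K :=
    mul_le_mul_of_nonneg_left (hK η) hc0
  have hsq : (√k * √k : ℝ) = k := Real.mul_self_sqrt hk0.le
  have hsk : (0 : ℝ) < √k := Real.sqrt_pos.mpr hk0
  have e0 : Real.exp (-(G.gap * s)) ≤ (√k)⁻¹ * (5 / 3 * Real.exp (-C)) := by
    have h3 : -(G.gap * s) = -(Real.log k / 2) + (1 / 4 + -C) := by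
      rw [hgs]
      ring
    rw [h3, Real.exp_add, exp_neg_half_log hk0, Real.exp_add]
    gcongr
    exact (Real.exp_le_exp.mpr (by norm_num)).trans exp_half_le
  have e1 : k * Real.exp (-(2 * G.gap * s)) ≤ 2 * Real.exp (-C) := by
    have h3 : -(2 * G.gap * s) =
        -(Real.log k / 2) + -(Real.log k / 2) + (1 / 2 + -C) + -C := by
      linear_combination (-2) * hgs
    have h4 : Real.exp (1 / 2 + -C) ≤ 2 :=
      ((Real.exp_le_exp.mpr (by linarith)).trans exp_half_le).trans (by norm_num)
    rw [h3, Real.exp_add, Real.exp_add, Real.exp_add (-(Real.log k / 2)), exp_neg_half_log hk0]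
    have h5 : (k : ℝ) * ((√k)⁻¹ * (√k)⁻¹ * Real.exp (1 / 2 + -C) * Real.exp (-C)) =
        Real.exp (1 / 2 + -C) * Real.exp (-C) := by
      generalize √(k : ℝ) = r at hsq hsk
      rw [← hsq]
      field_simp
    rw [h5]
    exact mul_le_mul_of_nonneg_right h4 (Real.exp_pos _).le
  -- The noise term loses only √k by time s; the missing √k is compensated by m, as √k m ≤ q.
  have e2 : k * (3 * (4 * K * m) * Real.exp (-(G.gap * s))) ≤
      12 * K * q * (2 * Real.exp (-C)) := by
    calc k * (3 * (4 * K * m) * Real.exp (-(G.gap * s)))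
        ≤ k * (3 * (4 * K * m) * ((√k)⁻¹ * (5 / 3 * Real.exp (-C)))) := by gcongr
      _ = 12 * K * (√k * m) * (5 / 3 * Real.exp (-C)) := by
        generalize √(k : ℝ) = r at hsq hsk
        rw [← hsq]
        field_simp
        ring
      _ ≤ 12 * K * q * (2 * Real.exp (-C)) := by
        have : 0 ≤ q := le_trans (by positivity) hq
        gcongr
        norm_num
  have e3 : k * c ≤ 3 * (2 * Real.exp (-C) + 12 * K * q * (2 * Real.exp (-C))) := by
    rw [hc]
    linarith
  have e4 := mul_le_mul_of_nonneg_left (h1.trans h2) hk0.le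
  have e5 := mul_le_mul_of_nonneg_right e3 hK0
  linarith

end WeightedGraph

end

/-! ### Uniformity in n and conclusion -/

theorem eventually_avgExpect_le {V : ℕ+ → Type*} [∀ n, Fintype (V n)] [∀ n, DecidableEq (V n)]
    (hV : ∀ n, Fintype.card (V n) = n) (G : ∀ n, WeightedGraph (V n))
    (hNash : FiniteDimensionalGeometry G) :
    ∃ K : ℝ, ∀ᶠ n in atTop, Nontrivial (V n) ∧
      ∀ η, (G n).avgExpect η ((G n).tRel / 4) ((G n).heatSq 0) ≤ K := by
  obtain ⟨d, N, T, h, hd, hN, hT⟩ := hNash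
  obtain ⟨D, hD0, hD⟩ := hd.exists_pos
  obtain ⟨c₁, hc₁, hN⟩ := hN.exists_pos
  obtain ⟨c₂, hc₂, hT⟩ := hT.2.exists_pos
  refine ⟨(2 * c₂) ^ (1 / (2 / D)) + (8 * c₁ / (2 / D)) ^ (1 / (2 / D)), ?_⟩
  filter_upwards [hD.bound, hN.bound, hT.bound, eventually_ge_atTop 2] with n h1 h2 h3 hn
  have hnt : Nontrivial (V n) := by
    rw [← Fintype.one_lt_card_iff_nontrivial, hV]
    exact_mod_cast hn
  obtain ⟨hd0, hN0, hT0, hNash⟩ := h n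
  rw [Real.norm_of_nonneg hd0.le, norm_one, mul_one] at h1
  rw [Real.norm_of_nonneg hN0.le, Real.norm_of_nonneg (G n).tRel_pos.le] at h2
  rw [Real.norm_of_nonneg hN0.le, Real.norm_of_nonneg hT0.le] at h3
  exact ⟨hnt, (G n).avgExpect_tRel_le_of_nash hd0 hN0 hNash h1 h2 hc₂
    (by rwa [← div_eq_mul_inv, div_le_iff₀ hT0])⟩

theorem mainTheorem3 {V : ℕ+ → Type*} [∀ n, Fintype (V n)] [∀ n, DecidableEq (V n)]
    (hV : ∀ n, Fintype.card (V n) = n) (G : ∀ n, WeightedGraph (V n))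
    (hNash : FiniteDimensionalGeometry G) (hEll : UniformlyElliptic G)
    (k : ℕ+ → ℕ) (hk : Tendsto k atTop atTop)
    (hkVol : (fun n => (k n : ℝ)) =O[atTop] fun n => (n : ℝ) ^ 2) :
    ∀ δ : ℝ, 0 < δ → δ < 1 → ∃ C : ℝ, 0 < C ∧ ∀ (p : ℝ) (hp : 1 ≤ p), p ≤ 2 →
      limsup (fun n => ((√(k n) * (G n).avgWorstDist p (zero_le_one.trans hp)
        ((G n).cutoffTime (k n) C) : ℝ) : EReal)) atTop ≤ (δ : EReal) ∧
      ((1 / δ : ℝ) : EReal) ≤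
        liminf (fun n => ((√(k n) * (G n).avgWorstDist p (zero_le_one.trans hp)
          ((G n).cutoffTime (k n) (-C)) : ℝ) : EReal)) atTop := by
  intro δ hδ _
  obtain ⟨K₀, hK₀⟩ := eventually_avgExpect_le hV G hNash
  obtain ⟨cE, hcE, hEll⟩ := hEll
  obtain ⟨c, hc, hkc⟩ := hkVol.exists_pos
  set K := max K₀ 0 with hKdef
  have hK0 : 0 ≤ K := le_max_right _ _
  set q := √c * cE with hq
  have hq0 : 0 ≤ q := by positivity
  set Q := 6 * K * (1 + 12 * K * q) with hQ
  have hQ0 : 0 ≤ Q := by positivity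
  -- As e^C ≥ C, this gives both Q e^{-C} ≤ δ² for the upper bound and (K + 1)²/δ ≤ e^C for the
  -- lower one.
  set C := 1 + Q / δ ^ 2 + (K + 1) ^ 2 / δ with hC
  have hC1 : 1 ≤ C := by
    have h1 : 0 ≤ Q / δ ^ 2 := by positivity
    have h2 : 0 ≤ (K + 1) ^ 2 / δ := by positivity
    linarith
  have hexpC : C ≤ Real.exp C := by linarith [Real.add_one_le_exp C]
  have hup : Q * Real.exp (-C) ≤ δ ^ 2 := by
    rw [Real.exp_neg, ← div_eq_mul_inv, div_le_iff₀ (Real.exp_pos _),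
      ← div_le_iff₀' (by positivity)]
    have : 0 ≤ (K + 1) ^ 2 / δ := by positivity
    linarith
  have hlow : (K + 1) ^ 2 * (1 / δ) ≤ Real.exp C := by
    have : 0 ≤ Q / δ ^ 2 := by positivity
    rw [mul_one_div]
    linarith
  -- Makes t⁻(C) nonnegative, as positivity of the semigroup requires.
  have hkbig : ∀ᶠ n in atTop, 2 * C ≤ Real.log (k n) :=
    (Real.tendsto_log_atTop.comp (tendsto_natCast_atTop_atTop.comp hk)).eventually_ge_atTop _
  have hK : ∀ᶠ n in atTop, Nontrivial (V n) ∧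
      ∀ η, (G n).avgExpect η ((G n).tRel / 4) ((G n).heatSq 0) ≤ K :=
    hK₀.mono fun n h => ⟨h.1, fun η => (h.2 η).trans (le_max_left _ _)⟩
  refine ⟨C, by linarith, fun p hp hp2 => ⟨?_, ?_⟩⟩
  · refine limsup_le_of_le (by isBoundedDefault) ?_
    filter_upwards [hK, hk.eventually_ge_atTop 1, hkc.bound] with n ⟨hnt, hKn⟩ hk1 hkn
    rw [EReal.coe_le_coe_iff]
    have hk0 : (0 : ℝ) < k n := by exact_mod_cast hk1
    have hsk : (0 : ℝ) < √(k n) := Real.sqrt_pos.mpr hk0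
    have hn0 : (0 : ℝ) < (n : ℝ) := by exact_mod_cast n.pos
    have hm : ∀ x, (G n).wt x ≤ cE / n := fun x => by
      simpa [hV] using (G n).wt_le_of_elliptic (hEll n) x
    have hsqrt : √(k n) ≤ √c * n := by
      rw [Real.norm_of_nonneg hk0.le, Real.norm_of_nonneg (by positivity)] at hkn
      refine (Real.sqrt_le_sqrt hkn).trans_eq ?_
      rw [Real.sqrt_mul hc.le, Real.sqrt_sq hn0.le]
    have hqn : √(k n) * (cE / n) ≤ q := by
      rw [mul_div_assoc', div_le_iff₀ hn0, hq]
      nlinarith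
    have ht : 0 ≤ (G n).cutoffTime (k n) C := by
      have h1 := (G n).tRel_pos
      have h2 : 0 ≤ Real.log (k n) := Real.log_nonneg (by exact_mod_cast hk1)
      have h3 : 0 ≤ C := by linarith
      unfold WeightedGraph.cutoffTime
      positivity
    have h1 := (G n).avgWorstDist_le hp hp2 (ε := δ / √(k n)) ht (by positivity) fun η => by
      have h2 := ((G n).mul_avgExpect_cutoffTime_le hKn hm hk1 hqn hC1 η).trans hup
      rw [div_pow, Real.sq_sqrt hk0.le, le_div_iff₀ hk0]
      linarith
    rw [le_div_iff₀ hsk] at h1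
    linarith
  · refine le_liminf_of_le (by isBoundedDefault) ?_
    filter_upwards [hK, hk.eventually_ge_atTop 1, hkbig] with n ⟨hnt, hKn⟩ hk1 hkl
    rw [EReal.coe_le_coe_iff]
    have hk0 : (0 : ℝ) < k n := by exact_mod_cast hk1
    have hsk : (0 : ℝ) < √(k n) := Real.sqrt_pos.mpr hk0
    have hτ := (G n).tRel_pos
    have hgτ := (G n).gap_mul_tRel
    have hct : (G n).cutoffTime (k n) (-C) = (Real.log (k n) / 2 - C) * (G n).tRel := by
      rw [WeightedGraph.cutoffTime]
      ring
    have ht : 0 ≤ (G n).cutoffTime (k n) (-C) := by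
      rw [hct]
      have : 0 ≤ Real.log (k n) / 2 - C := by linarith
      positivity
    have h1 := (G n).exp_le_mul_avgWorstDist (b := (G n).tRel / 4) (by positivity)
      (by linarith) hKn hp ht
    have h2 : -((G n).gap * (G n).cutoffTime (k n) (-C)) = -(Real.log (k n) / 2) + C := by
      rw [hct]
      linear_combination (C - Real.log (k n) / 2) * hgτ
    rw [h2, Real.exp_add, WeightedGraph.exp_neg_half_log hk0, inv_mul_le_iff₀ hsk] at h1
    have h3 : (K + 1) ^ 2 * (1 / δ) ≤ (K + 1) ^ 2 * (√(k n) *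
        (G n).avgWorstDist p (zero_le_one.trans hp) ((G n).cutoffTime (k n) (-C))) := by
      linarith
    exact le_of_mul_le_mul_left h3 (by positivity)
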